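/- **Setting.** Let $\lambda>0$ and let $B$ be the distribution function of a nonnegative random variable $\chi$ with $B(0)=0$; write $\overline B=1-B$ and $\widehat B(\lambda)=\int_0^\infty e^{-\lambda x}\,dB(x)$. For $y\ge0$ let $B_y(x)=\Pr\{\chi\le x+y\mid\chi>y\}=1-\overline B(x+y)/\overline B(y)$ for $x\ge 0$, with the convention $0/0=0$ (so $B_y$ is the unit mass at $0$ if $\overline B(y)=0$). For distribution functions $\Xi_1,\Xi_2$ on $[0,\infty)$ write $\Xi_1\le_{\mathscr C_\lambda}\Xi_2$ if $\int_0^\infty e^{-\lambda x}x^i\,\Xi_1(x)\,dx\ge\int_0^\infty e^{-\lambda x}x^i\,\Xi_2(x)\,dx$ for all $i=0,1,2,\dots$. For $\mathbb{N}$-valued random variables, $U\le_{st}V$ means $\Pr\{U\ge m\}\le\Pr\{V\ge m\}$ for all $m$. Let $L_n$ be the number of customers lost during a busy period of the $M/GI/1/n$ queue ($n\ge 0$ waiting places besides the customer in service) with Poisson input of rate $\lambda$ and i.i.d. service times, independent of the input, with distribution function $B$. **Theorem.** Assume that * (C) $B$ is NBU, i.e. $\overline B(x+y)\le\overline B(x)\overline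 B(y)$ for all $x,y\ge0$, and $\sup_{x,y\ge0}|B_y(x)-B(x)|<\varepsilon$; * (E) there is $y^0\ge0$ with $B_{y^0}\le_{\mathscr C_\lambda}B_y$ for all $y\ge0$. Then there are two Galton–Watson processes $(X_n)_{n\ge0}$ and $(Y_n)_{n\ge0}$ with $X_0=Y_0=1$ and offspring generating functions $g_X$ and $g_Y$ such that $$g_X(z)<\frac{\widehat B(\lambda)}{1-z+z\widehat B(\lambda)}+\varepsilon\cdot\frac{1-z+2z\widehat B(\lambda)}{1-z+z\widehat B(\lambda)}\qquad(0\le z\le1),$$ and, for complex $z$, $$\left|g_X(z)-\frac{\widehat B(\lambda)}{1-z+z\widehat B(\lambda)}\right|<\varepsilon\cdot\frac{1-|z|+2|z|\widehat B(\lambda)}{1-|z|+|z|\widehat B(\lambda)},\qquad g_Y(z)=\frac{\widehat B(\lambda)}{1-z+z\widehat B(\lambda)}\qquad(|z|\le1),$$ and such that for every $n\ge0$ $$\sum_{i=1}^{X_n}\varsigma_i\ \le_{st}\ L_n\ \le_{st}\ \sum_{i=1}^{Y_n}\upsilon_i .$$ Here $\varsigma_1,\varsigma_2,\dots$ are i.i.d.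 and independent of $X_n$, $\upsilon_1,\upsilon_2,\dots$ are i.i.d. and independent of $Y_n$, and for $m=0,1,2,\dots$ $$\Pr\{\varsigma_i=m\}=\int_0^\infty e^{-\lambda x}\frac{(\lambda x)^m}{m!}\,dB_{y^0}(x),\qquad \Pr\{\upsilon_i=m\}=\int_0^\infty e^{-\lambda x}\frac{(\lambda x)^m}{m!}\,dB(x).$$ -/

import Mathlib

open MeasureTheory ProbabilityTheory
open scoped NNReal

noncomputable section

namespace LossQueue

/-! ### Distributions on the half-line -/

/-- The Laplace–Stieltjes transform `∫ e^{-λx} dG(x)` of a law `G` on `[0, ∞)`. -/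
def laplace (G : Measure ℝ) (lam : ℝ) : ℝ :=
  ∫ x, Real.exp (-(lam * x)) ∂G

/-- The class NBU (new better than used):
`1 - B(x + y) ≤ (1 - B(x)) (1 - B(y))` for all `x, y ≥ 0`. -/
def IsNBU (B : Measure ℝ) : Prop :=
  ∀ x y : ℝ, 0 ≤ x → 0 ≤ y →
    1 - cdf B (x + y) ≤ (1 - cdf B x) * (1 - cdf B y)

open Classical in
/-- The residual law `B_y(x) = Pr{χ ≤ x + y | χ > y}`, i.e. the law of `χ - y` given `χ > y`, where
`χ` has law `B`.  If `Pr{χ > y} = 0`, the convention `0 / 0 = 0` for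
`1 - B_y(x) = (1 - B(x + y)) / (1 - B(y))` makes `B_y` the unit mass at `0`. -/
def residual (B : Measure ℝ) (y : ℝ) : Measure ℝ :=
  if B (Set.Ioi y) = 0 then Measure.dirac 0
  else (ProbabilityTheory.cond B (Set.Ioi y)).map (fun x => x - y)

instance residual.isProbabilityMeasure (B : Measure ℝ) [IsProbabilityMeasure B] (y : ℝ) :
    IsProbabilityMeasure (residual B y) := by
  unfold residual
  split_ifs with h
  · infer_instance
  · have : IsProbabilityMeasure (ProbabilityTheory.cond B (Set.Ioi y)) :=
      cond_isProbabilityMeasure h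
    exact Measure.isProbabilityMeasure_map (by fun_prop)

/-- `sup_{x, y ≥ 0} |B_y(x) - B(x)| < ε`.  The supremum is over a nonempty set of numbers bounded
by `1`. -/
def NearMemoryless (B : Measure ℝ) (ε : ℝ) : Prop :=
  (⨆ p : ℝ≥0 × ℝ≥0, |cdf (residual B p.2) p.1 - cdf B p.1|) < ε

/-- The order relation `Ξ₁ ≤ Ξ₂` in the sense of `𝒞_λ`:
`∫₀^∞ e^{-λx} xⁱ Ξ₁(x) dx ≥ ∫₀^∞ e^{-λx} xⁱ Ξ₂(x) dx` for all `i = 0, 1, …`. -/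
def CLe (lam : ℝ) (Ξ₁ Ξ₂ : Measure ℝ) : Prop :=
  ∀ i : ℕ, ∫ x in Set.Ioi (0 : ℝ), Real.exp (-(lam * x)) * x ^ i * cdf Ξ₂ x
    ≤ ∫ x in Set.Ioi (0 : ℝ), Real.exp (-(lam * x)) * x ^ i * cdf Ξ₁ x

/-! ### Laws on the nonnegative integers -/

/-- The mixed Poisson law on `ℕ` with mixing law `G` on `[0, ∞)`:
`Pr{θ = m} = ∫₀^∞ e^{-λx} (λx)^m / m! dG(x)`. -/
def mixedPoisson (lam : ℝ) (G : Measure ℝ) : Measure ℕ :=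
  Measure.sum fun m : ℕ =>
    ENNReal.ofReal
      (∫ x in Set.Ici (0 : ℝ), Real.exp (-(lam * x)) * (lam * x) ^ m / (m.factorial : ℝ) ∂G)
        • Measure.dirac m

/-- The usual stochastic order between laws on `ℕ`: all upper tails are ordered. -/
def StLe (μ ν : Measure ℕ) : Prop :=
  ∀ m : ℕ, μ (Set.Ici m) ≤ ν (Set.Ici m)

/-- The law of `ξ₁ + ⋯ + ξ_k` for independent `ξ_i` with law `μ`. -/
def iidSum (μ : Measure ℕ) : ℕ → Measure ℕ
  | 0 => Measure.dirac 0
  | k + 1 => Measure.conv (iidSum μ k) μ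

/-- The law of the random sum `ξ₁ + ⋯ + ξ_K`, where `K` has law `ν`, the `ξ_i` are i.i.d. with
law `μ`, and `K` is independent of the `ξ_i`. -/
def randomSum (ν μ : Measure ℕ) : Measure ℕ :=
  ν.bind (iidSum μ)

/-- The law of the size of the `j`-th generation of the Galton–Watson process started from one
individual, with offspring law `p`: generation `j + 1` is the sum of the i.i.d. offspring numbers
of the individuals of generation `j`. -/
def galtonWatson (p : PMF ℕ) : ℕ → Measure ℕ
  | 0 => Measure.dirac 1
  | j + 1 => randomSum (galtonWatson p j) p.toMeasure

/-- The probability generating function `∑ p_m z^m` of a law on `ℕ`, at a real or complex `z`. -/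
def pgf {𝕜 : Type*} [RCLike 𝕜] (p : PMF ℕ) (z : 𝕜) : 𝕜 :=
  ∑' m : ℕ, (((p m).toReal : ℝ) : 𝕜) * z ^ m

/-! ### The `M/GI/1/n` queue -/

/-- A (homogeneous) Poisson process of rate `lam`; `N t` counts the points in `(0, t]`. -/
structure IsPoissonProcess {Ω : Type*} [MeasurableSpace Ω] (lam : ℝ≥0) (N : ℝ≥0 → Ω → ℕ)
    (P : Measure Ω) : Prop where
  measurable : ∀ t, Measurable (N t)
  start : ∀ ω, N 0 ω = 0
  mono : ∀ ω, Monotone fun t => N t ω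
  right_continuous : ∀ ω t, ContinuousWithinAt (fun s => N s ω) (Set.Ici t) t
  increment_law : ∀ s t, s ≤ t →
    P.map (fun ω => N t ω - N s ω) = poissonMeasure (lam * (t - s))
  indep_increments : HasIndepIncrements N P

/-- The random data of an `M/GI/1` system over a busy period that an arriving customer opens at
time `0`: `N` is the Poisson process, of rate `lam`, of the later arrivals, `S k` is the duration
of the `(k + 1)`-st service, the `S k` are i.i.d. with law `B`, and they are independent
of `N`. -/
structure IsQueueInput {Ω : Type*} [MeasurableSpace Ω] (lam : ℝ≥0) (B : Measure ℝ)
    (N : ℝ≥0 → Ω → ℕ) (S : ℕ → Ω → ℝ) (P : Measure Ω) : Prop where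
  poisson : IsPoissonProcess lam N P
  measurable_service : ∀ k, Measurable (S k)
  service_law : ∀ k, P.map (S k) = B
  indep_service : iIndepFun S P
  indep_arrivals_service : IndepFun (fun ω t => N t ω) (fun ω k => S k ω) P

section Path

/-- The end of the `k`-th service.  The server never idles inside a busy period, so services follow
one another without gaps, from time `0` on. -/
def serviceEnd (s : ℕ → ℝ) (k : ℕ) : ℝ≥0 :=
  (∑ i ∈ Finset.range k, s i).toNNReal

/-- The number of customers who arrive during the `(k + 1)`-st service. -/
def arrivals (c : ℝ≥0 → ℕ) (s : ℕ → ℝ) (k : ℕ) : ℕ :=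
  c (serviceEnd s (k + 1)) - c (serviceEnd s k)

/-- The number of customers in the system just after the `k`-th service has ended (for `k = 0`: just
after time `0`), if `a k` customers arrive during the `(k + 1)`-st service.  There is room for
`n + 1` customers (`n` waiting and one in service); during a service each arrival increases the
number in the system by one, up to `n + 1`; the end of the service decreases it by one.  The state
`0` ends the busy period and is kept. -/
def numInSystem (n : ℕ) (a : ℕ → ℕ) : ℕ → ℕ
  | 0 => 1
  | k + 1 => if numInSystem n a k = 0 then 0 else min (numInSystem n a k + a k) (n + 1) - 1

/-- The number of services in the busy period: the first `k` such that the `k`-th service leaves an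
empty system. -/
def numServices (n : ℕ) (a : ℕ → ℕ) : ℕ :=
  sInf {k | numInSystem n a k = 0}

/-- The number of losses during the busy period: of the `a k` customers who arrive during
a service that starts with `q` customers in the system, the first `n + 1 - q` are admitted and all
others are lost. -/
def losses (n : ℕ) (a : ℕ → ℕ) : ℕ :=
  ∑ k ∈ Finset.range (numServices n a), (a k - (n + 1 - numInSystem n a k))

end Path

/-- `L_n`, the number of losses during a busy period of the `M/GI/1/n` queue with arrival counting
process `N` and service times `S` (almost surely, the busy period is finite). -/
def busyPeriodLosses {Ω : Type*} (n : ℕ) (N : ℝ≥0 → Ω → ℕ) (S : ℕ → Ω → ℝ) (ω : Ω) : ℕ :=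
  losses n (arrivals (fun t => N t ω) (fun k => S k ω))

end LossQueue

end

noncomputable section

/-! The numbers of arrivals during successive services are i.i.d. with the mixed Poisson law `π` of
`B` (`IsQueueInput.map_arrivals`), so only `π` matters. At least `k` arrivals occur in a service
exactly when it outlasts an Erlang time. Splitting Erlang times into independent parts therefore
carries the assumptions on `B` over to `π`. NBU gives `π[r + m, ∞) ≤ π[r, ∞) π[m, ∞)`, and
minimality of `B_{y₀}` gives `π[r, ∞) c[m, ∞) ≤ π[r + m, ∞)`, where `c` is the mixed Poisson law of
`B_{y₀}`. In words: after `r` arrivals, the number still to come in the same service lies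
stochastically between `c` and `π`.

Levels are measured by the free room. The busy period is the passage from room `n` to room `n + 1`.
A passage from room `m + 1` to `m + 2` makes some number of excursions to room `m`, each returning
to `m + 1` by a passage one level lower. An excursion begins in the middle of a service, so
`lossSeries` records the number `r` of arrivals already seen. Renewal at the end of an excursion
expresses the new series through `b / (1 - F)`, with `b = π{0}` and `F` the series of one excursion.

Induction on the level (`lossSeries_bounds`) compares these series with random sums. For the upper
bound the number of excursions is geometric with parameter `b`. For the lower bound its mass at `0`
becomes `a = c{0}`, because only the first comparison starts after `r` arrivals in a running
service; the restarts still see `π`. Iterating a random sum `n` times is summing over generation `n`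
of a Galton-Watson process (`randomSum_galtonWatson`), and at level `0` the bounds are `c` and `π`
themselves.

A first-step equation with a unique solution identifies `passageSeries` with the law of the losses.
Finally `a` and `b` are Laplace transforms of `B_{y₀}` and `B`, so `|a - b| < ε`, and the generating
functions differ by `(a - b)` times an explicit fraction. -/

namespace LossQueue

/-! ### Generating series, random sums and Galton-Watson generations -/

/-- The power series whose coefficients are the point masses of a law on `ℕ`. -/
def massSeries (μ : Measure ℕ) : PowerSeries ℝ := PowerSeries.mk fun k => μ.real {k}

@[simp]
theorem coeff_massSeries (μ : Measure ℕ) (k : ℕ) :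
    PowerSeries.coeff k (massSeries μ) = μ.real {k} := by
  simp [massSeries]

theorem massSeries_dirac (j : ℕ) : massSeries (Measure.dirac j) = PowerSeries.X ^ j := by
  ext k
  rw [coeff_massSeries, PowerSeries.coeff_X_pow, Measure.real,
    Measure.dirac_apply' _ (measurableSet_singleton k)]
  by_cases h : k = j
  · simp [h]
  · simp [h, Ne.symm h]

theorem massSeries_conv (μ ν : Measure ℕ) [IsProbabilityMeasure μ] [IsProbabilityMeasure ν] :
    massSeries (μ.conv ν) = massSeries μ * massSeries ν := by
  ext k
  rw [coeff_massSeries, PowerSeries.coeff_mul, Measure.conv,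
    map_measureReal_apply (by fun_prop) (measurableSet_singleton k)]
  have : (fun x : ℕ × ℕ => x.1 + x.2) ⁻¹' {k} =
      ((Finset.HasAntidiagonal.antidiagonal k : Finset (ℕ × ℕ)) : Set (ℕ × ℕ)) := by
    ext x; simp
  rw [this, ← sum_measureReal_singleton]
  refine Finset.sum_congr rfl fun x _ => ?_
  rw [coeff_massSeries, coeff_massSeries, ← measureReal_prod_prod, Set.singleton_prod_singleton]

instance iidSum.isProbabilityMeasure (μ : Measure ℕ) [IsProbabilityMeasure μ] (k : ℕ) :
    IsProbabilityMeasure (iidSum μ k) := by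
  induction k with
  | zero => unfold iidSum; infer_instance
  | succ k ih => unfold iidSum; infer_instance

instance randomSum.isProbabilityMeasure (ν μ : Measure ℕ) [IsProbabilityMeasure ν]
    [IsProbabilityMeasure μ] : IsProbabilityMeasure (randomSum ν μ) := by
  constructor
  rw [randomSum, Measure.bind_apply MeasurableSet.univ (measurable_of_countable _).aemeasurable]
  simp

instance galtonWatson.isProbabilityMeasure (p : PMF ℕ) (j : ℕ) :
    IsProbabilityMeasure (galtonWatson p j) := by
  induction j with
  | zero => unfold galtonWatson; infer_instance
  | succ j ih => unfold galtonWatson; infer_instance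

theorem massSeries_iidSum (μ : Measure ℕ) [IsProbabilityMeasure μ] (k : ℕ) :
    massSeries (iidSum μ k) = massSeries μ ^ k := by
  induction k with
  | zero => simp [iidSum, massSeries_dirac]
  | succ k ih => rw [iidSum, massSeries_conv, ih, pow_succ]

theorem iidSum_add (μ : Measure ℕ) [IsProbabilityMeasure μ] (i j : ℕ) :
    iidSum μ (i + j) = (iidSum μ i).conv (iidSum μ j) := by
  induction j with
  | zero => simp [iidSum]
  | succ j ih => rw [← add_assoc, iidSum, ih, iidSum, Measure.conv_assoc]

theorem lintegral_randomSum (ν μ : Measure ℕ) (f : ℕ → ENNReal) :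
    ∫⁻ x, f x ∂(randomSum ν μ) = ∫⁻ k, ∫⁻ x, f x ∂(iidSum μ k) ∂ν :=
  Measure.lintegral_bind (measurable_of_countable _).aemeasurable
    (measurable_of_countable _).aemeasurable

theorem randomSum_conv (α β μ : Measure ℕ) [IsProbabilityMeasure α] [IsProbabilityMeasure β]
    [IsProbabilityMeasure μ] :
    randomSum (α.conv β) μ = (randomSum α μ).conv (randomSum β μ) := by
  refine Measure.ext_of_lintegral _ fun f _ => ?_
  have hm : ∀ g : ℕ → ENNReal, Measurable g := fun g => measurable_of_countable g
  rw [lintegral_randomSum, Measure.lintegral_conv (hm _), Measure.lintegral_conv (hm _),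
    lintegral_randomSum]
  refine lintegral_congr fun i => ?_
  simp_rw [lintegral_randomSum, iidSum_add, Measure.lintegral_conv (hm _)]
  rw [lintegral_lintegral_swap (measurable_of_countable _).aemeasurable]

theorem iidSum_randomSum (p μ : Measure ℕ) [IsProbabilityMeasure p] [IsProbabilityMeasure μ]
    (k : ℕ) : iidSum (randomSum p μ) k = randomSum (iidSum p k) μ := by
  induction k with
  | zero => rw [iidSum, iidSum, randomSum, Measure.dirac_bind (measurable_of_countable _), iidSum]
  | succ k ih => rw [iidSum, iidSum, randomSum_conv, ih]

/-- Associativity: the summands may be grouped by the individual whose offspring they belong to. -/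
theorem randomSum_randomSum (ν p μ : Measure ℕ) [IsProbabilityMeasure p] [IsProbabilityMeasure μ] :
    randomSum (randomSum ν p) μ = randomSum ν (randomSum p μ) := by
  unfold randomSum
  rw [Measure.bind_bind (measurable_of_countable _).aemeasurable
    (measurable_of_countable _).aemeasurable]
  congr 1
  funext k
  exact (iidSum_randomSum p μ k).symm

/-- Summing i.i.d. variables over the `n`-th generation of a Galton-Watson process is the `n`-fold
iterate of summing over the offspring of one individual. -/
theorem randomSum_galtonWatson (p : PMF ℕ) (n : ℕ) (μ : Measure ℕ) [IsProbabilityMeasure μ] :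
    randomSum (galtonWatson p n) μ = (randomSum p.toMeasure)^[n] μ := by
  induction n generalizing μ with
  | zero =>
    rw [galtonWatson, randomSum, Measure.dirac_bind (measurable_of_countable _)]
    simp [iidSum]
  | succ n ih => rw [galtonWatson, randomSum_randomSum, ih, Function.iterate_succ_apply]

instance randomSum_iterate.isProbabilityMeasure (p μ : Measure ℕ) [IsProbabilityMeasure p]
    [IsProbabilityMeasure μ] (n : ℕ) : IsProbabilityMeasure ((randomSum p)^[n] μ) := by
  induction n with
  | zero => simpa
  | succ n ih => rw [Function.iterate_succ_apply']; infer_instance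

theorem hasSum_measureReal_singleton (ν : Measure ℕ) [IsProbabilityMeasure ν] :
    HasSum (fun k => ν.real {k}) 1 := by
  have h : ∑' k, ν {k} = 1 := by
    have := Measure.tsum_indicator_apply_singleton ν Set.univ MeasurableSet.univ
    simpa using this
  have := ENNReal.hasSum_toReal (f := fun k => ν {k}) (by rw [h]; simp)
  rwa [← ENNReal.tsum_toReal_eq (fun k => measure_ne_top _ _), h, ENNReal.toReal_one] at this

theorem coeff_massSeries_randomSum (ν μ : Measure ℕ) [IsProbabilityMeasure ν]
    [IsProbabilityMeasure μ] (i : ℕ) :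
    HasSum (fun k => ν.real {k} * PowerSeries.coeff i (massSeries μ ^ k))
      (PowerSeries.coeff i (massSeries (randomSum ν μ))) := by
  have h : randomSum ν μ {i} = ∑' k, iidSum μ k {i} * ν {k} := by
    rw [randomSum, Measure.bind_apply (measurableSet_singleton i)
      (measurable_of_countable _).aemeasurable, lintegral_countable']
  have := ENNReal.hasSum_toReal (f := fun k => iidSum μ k {i} * ν {k})
    (by rw [← h]; exact measure_ne_top _ _)
  rw [← ENNReal.tsum_toReal_eq
    (fun k => ENNReal.mul_ne_top (measure_ne_top _ _) (measure_ne_top _ _)), ← h] at this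
  have h' : (fun k => (iidSum μ k {i} * ν {k}).toReal) =
      fun k => ν.real {k} * PowerSeries.coeff i (massSeries μ ^ k) := by
    funext k
    rw [← massSeries_iidSum, coeff_massSeries, ENNReal.toReal_mul, mul_comm]
    rfl
  rw [h'] at this
  rwa [coeff_massSeries]

/-! ### Delayed geometric laws -/

/-- The weights of a geometric law with success parameter `b` whose mass at `0` has been changed
to `a`. -/
def delayedGeometricWeight (a b : ℝ) : ℕ → ℝ
  | 0 => a
  | k + 1 => (1 - a) * (b * (1 - b) ^ k)

theorem delayedGeometricWeight_nonneg {a b : ℝ} (ha : 0 ≤ a) (ha' : a ≤ 1) (hb : 0 < b)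
    (hb' : b ≤ 1) (k : ℕ) : 0 ≤ delayedGeometricWeight a b k := by
  cases k with
  | zero => exact ha
  | succ k =>
    exact mul_nonneg (by linarith) (mul_nonneg hb.le (pow_nonneg (by linarith) k))

theorem delayedGeometricWeight_self (b : ℝ) (k : ℕ) :
    delayedGeometricWeight b b k = b * (1 - b) ^ k := by
  cases k with
  | zero => simp [delayedGeometricWeight]
  | succ k => rw [delayedGeometricWeight]; ring

theorem hasSum_delayedGeometricWeight (a : ℝ) {b : ℝ} (hb : 0 < b) (hb' : b ≤ 1) :
    HasSum (delayedGeometricWeight a b) 1 := by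
  have h := (hasSum_geometric_of_lt_one (r := 1 - b) (by linarith) (by linarith)).mul_left
    ((1 - a) * b)
  rw [← hasSum_nat_add_iff' 1]
  have h1 : (1 - a) * b * (1 - (1 - b))⁻¹ =
      1 - ∑ i ∈ Finset.range 1, delayedGeometricWeight a b i := by
    simp [delayedGeometricWeight, hb.ne']
  rw [h1] at h
  simpa only [delayedGeometricWeight, mul_assoc] using h

/-- The law on `ℕ` with weights `delayedGeometricWeight a b`. -/
def delayedGeometric (a b : ℝ) (ha : 0 ≤ a) (ha' : a ≤ 1) (hb : 0 < b) (hb' : b ≤ 1) : PMF ℕ :=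
  ⟨fun k => ENNReal.ofReal (delayedGeometricWeight a b k), by
    have h := hasSum_delayedGeometricWeight a hb hb'
    have h0 := delayedGeometricWeight_nonneg ha ha' hb hb'
    rw [ENNReal.summable.hasSum_iff, ← ENNReal.ofReal_tsum_of_nonneg h0 h.summable, h.tsum_eq,
      ENNReal.ofReal_one]⟩

section
variable {a b : ℝ} (ha : 0 ≤ a) (ha' : a ≤ 1) (hb : 0 < b) (hb' : b ≤ 1)

theorem delayedGeometric_apply (k : ℕ) :
    (delayedGeometric a b ha ha' hb hb' k).toReal = delayedGeometricWeight a b k :=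
  ENNReal.toReal_ofReal (delayedGeometricWeight_nonneg ha ha' hb hb' k)

/-- First-step decomposition of a random sum with a delayed geometric number of terms. -/
theorem massSeries_randomSum_delayedGeometric (μ : Measure ℕ) [IsProbabilityMeasure μ] :
    massSeries (randomSum (delayedGeometric a b ha ha' hb hb').toMeasure μ) =
      PowerSeries.C a + PowerSeries.C (1 - a) * massSeries μ *
        massSeries (randomSum (delayedGeometric b b hb.le hb' hb hb').toMeasure μ) := by
  have hs : ∀ {c : ℝ} (hc : 0 ≤ c) (hc' : c ≤ 1) (k : ℕ),
      (delayedGeometric c b hc hc' hb hb').toMeasure.real {k} = delayedGeometricWeight c b k := by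
    intro c hc hc' k
    rw [Measure.real, PMF.toMeasure_apply_singleton _ _ (measurableSet_singleton k),
      delayedGeometric_apply]
  ext i
  have h1 := coeff_massSeries_randomSum (delayedGeometric a b ha ha' hb hb').toMeasure μ i
  simp_rw [hs] at h1
  rw [← hasSum_nat_add_iff' 1] at h1
  have h2 := hasSum_sum fun (x : ℕ × ℕ) (_ : x ∈ Finset.HasAntidiagonal.antidiagonal i) =>
    (coeff_massSeries_randomSum (delayedGeometric b b hb.le hb' hb hb').toMeasure μ x.2).mul_left
      (PowerSeries.coeff x.1 (massSeries μ))
  rw [← PowerSeries.coeff_mul] at h2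
  simp_rw [hs] at h2
  have h3 := h2.mul_left (1 - a)
  -- Given that it is positive, the number of terms is one plus a geometric number, so one summand
  -- splits off from a purely geometric sum.
  have h4 : (fun k => (1 - a) * ∑ x ∈ Finset.HasAntidiagonal.antidiagonal i,
      PowerSeries.coeff x.1 (massSeries μ) *
        (delayedGeometricWeight b b k * PowerSeries.coeff x.2 (massSeries μ ^ k))) =
      fun k => delayedGeometricWeight a b (k + 1) *
        PowerSeries.coeff i (massSeries μ ^ (k + 1)) := by
    funext k
    rw [pow_succ', PowerSeries.coeff_mul, Finset.mul_sum, Finset.mul_sum]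
    refine Finset.sum_congr rfl fun x _ => ?_
    rw [delayedGeometricWeight_self, delayedGeometricWeight]
    ring
  rw [h4] at h3
  rw [map_add, mul_assoc, PowerSeries.coeff_C_mul, ← h1.unique h3]
  simp [delayedGeometricWeight, PowerSeries.coeff_C, PowerSeries.coeff_one]
end

/-! ### Power series with nonnegative coefficients -/

/-- All coefficients are nonnegative. -/
def CoeffNonneg (f : PowerSeries ℝ) : Prop :=
  ∀ i, 0 ≤ PowerSeries.coeff i f

theorem CoeffNonneg.add {f g : PowerSeries ℝ} (hf : CoeffNonneg f) (hg : CoeffNonneg g) :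
    CoeffNonneg (f + g) := fun i => by
  rw [map_add]; exact add_nonneg (hf i) (hg i)

theorem CoeffNonneg.mul {f g : PowerSeries ℝ} (hf : CoeffNonneg f) (hg : CoeffNonneg g) :
    CoeffNonneg (f * g) := fun i => by
  rw [PowerSeries.coeff_mul]; exact Finset.sum_nonneg fun x _ => mul_nonneg (hf _) (hg _)

theorem coeffNonneg_C {a : ℝ} (ha : 0 ≤ a) : CoeffNonneg (PowerSeries.C a) := fun i => by
  rw [PowerSeries.coeff_C]; split_ifs <;> simp [ha]

theorem coeffNonneg_massSeries (μ : Measure ℕ) : CoeffNonneg (massSeries μ) := fun i => by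
  rw [coeff_massSeries]; exact measureReal_nonneg

theorem CoeffNonneg.of_C_mul {a : ℝ} (ha : 0 < a) {f : PowerSeries ℝ}
    (h : CoeffNonneg (PowerSeries.C a * f)) : CoeffNonneg f := fun i => by
  have := h i
  rw [PowerSeries.coeff_C_mul] at this
  exact nonneg_of_mul_nonneg_right this ha

/-- A power series `f` with nonnegative coefficients and constant coefficient less than `1` has
a geometric series `1 / (1 - f)` with nonnegative coefficients. -/
theorem CoeffNonneg.inv_one_sub {f : PowerSeries ℝ} (hf : CoeffNonneg f)
    (h1 : PowerSeries.coeff 0 f < 1) : CoeffNonneg (1 - f)⁻¹ := by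
  intro i
  induction i using Nat.strong_induction_on with
  | _ i ih =>
    rw [PowerSeries.coeff_inv]
    have h0 : PowerSeries.constantCoeff (1 - f) = 1 - PowerSeries.coeff 0 f := by simp
    have hp : 0 < (PowerSeries.constantCoeff (1 - f))⁻¹ := by
      rw [h0]; exact inv_pos.mpr (by linarith)
    split_ifs with hi
    · exact hp.le
    -- The recursion for the inverse uses only coefficients of `1 - f` of positive index. These are
    -- the negatives of those of `f`, and the sign cancels.
    · rw [neg_mul, ← mul_neg, ← Finset.sum_neg_distrib]
      refine mul_nonneg hp.le (Finset.sum_nonneg fun x hxi => ?_)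
      split_ifs with hx
      · have hx1 : x.1 ≠ 0 := by
          rintro h
          have := Finset.HasAntidiagonal.mem_antidiagonal.mp hxi
          omega
        rw [map_sub, PowerSeries.coeff_one, if_neg hx1, zero_sub, neg_mul, neg_neg]
        exact mul_nonneg (hf _) (ih _ hx)
      · simp

/-- The series `1 + X + X² + ⋯`; multiplication by it forms partial sums. -/
def onesSeries : PowerSeries ℝ := PowerSeries.mk fun _ => 1

theorem coeff_mul_onesSeries (f : PowerSeries ℝ) (i : ℕ) :
    PowerSeries.coeff i (f * onesSeries) =
      ∑ k ∈ Finset.range (i + 1), PowerSeries.coeff k f := by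
  rw [PowerSeries.coeff_mul, Finset.Nat.sum_antidiagonal_eq_sum_range_succ_mk]
  simp [onesSeries]

theorem measureReal_singleton_eq_sub (π : Measure ℕ) [IsProbabilityMeasure π] (r : ℕ) :
    π.real {r} = π.real (Set.Ici r) - π.real (Set.Ici (r + 1)) := by
  have : Set.Ici r = {r} ∪ Set.Ici (r + 1) := by ext x; simp; omega
  rw [this, measureReal_union (by simp) measurableSet_Ici]
  ring

theorem measureReal_Ici_zero (π : Measure ℕ) [IsProbabilityMeasure π] :
    π.real (Set.Ici 0) = 1 := by
  have : Set.Ici (0 : ℕ) = Set.univ := by ext x; simp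
  simp [this]

theorem sum_measureReal_singleton_add (π : Measure ℕ) [IsProbabilityMeasure π] (r i : ℕ) :
    ∑ k ∈ Finset.range i, π.real {r + k} = π.real (Set.Ici r) - π.real (Set.Ici (r + i)) := by
  induction i with
  | zero => simp
  | succ i ih => rw [Finset.sum_range_succ, ih, measureReal_singleton_eq_sub, add_assoc]; ring

/-- Hence `CoeffNonneg ((massSeries μ - massSeries ν) * onesSeries)` encodes `StLe μ ν`. In this
form the order survives multiplication by any series with nonnegative coefficients. -/
theorem coeff_massSeries_mul_onesSeries (μ : Measure ℕ) [IsProbabilityMeasure μ] (i : ℕ) :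
    PowerSeries.coeff i (massSeries μ * onesSeries) = 1 - μ.real (Set.Ici (i + 1)) := by
  rw [coeff_mul_onesSeries, ← measureReal_Ici_zero μ]
  have := sum_measureReal_singleton_add μ 0 (i + 1)
  simp only [zero_add] at this
  rw [← this]
  simp

theorem coeffNonneg_one_sub_massSeries_mul_onesSeries (μ : Measure ℕ) [IsProbabilityMeasure μ] :
    CoeffNonneg ((1 - massSeries μ) * onesSeries) := fun i => by
  rw [sub_mul, map_sub, coeff_massSeries_mul_onesSeries, one_mul]
  simp [onesSeries]

/-! ### Losses during the passage from one level to the level below -/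

/-- The masses of `π` from `r` on, as a power series. -/
def tailSeries (π : Measure ℕ) (r : ℕ) : PowerSeries ℝ :=
  PowerSeries.mk fun k => π.real {r + k}

/-- Generating series, on the event that `r` customers have arrived during the present service, of
the number of later losses until the system first has room for `m + 1` further customers, if there
is room for `m` after these `r` arrivals; the numbers of arrivals per service have law `π`. -/
def lossSeries (π : Measure ℕ) : ℕ → ℕ → PowerSeries ℝ
  | 0, r => tailSeries π r
  | m + 1, r => PowerSeries.C (π.real {r}) +
      lossSeries π m (r + 1) * (PowerSeries.C (π.real {0}) * (1 - lossSeries π m 1)⁻¹)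

/-- Generating series of the number of losses until there first is room for `m + 1` customers, if
a service starts with room for `m` customers. -/
def passageSeries (π : Measure ℕ) (m : ℕ) : PowerSeries ℝ := lossSeries π m 0

/-- A service without arrivals completes the passage. Otherwise the first arrival starts an
excursion one level down, after which the passage starts afresh: `D = π{0} + F D`. -/
theorem passageSeries_succ_eq {π : Measure ℕ} {m : ℕ}
    (h : PowerSeries.coeff 0 (lossSeries π m 1) < 1) :
    passageSeries π (m + 1) = PowerSeries.C (π.real {0}) * (1 - lossSeries π m 1)⁻¹ := by
  have h0 : PowerSeries.constantCoeff (1 - lossSeries π m 1) ≠ 0 := by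
    simp only [map_sub, map_one, PowerSeries.coeff_zero_eq_constantCoeff] at h ⊢
    linarith
  have := PowerSeries.mul_inv_cancel _ h0
  rw [passageSeries, lossSeries]
  linear_combination (-PowerSeries.C (π.real {0})) * this

theorem lossSeries_succ {π : Measure ℕ} {m : ℕ}
    (h : PowerSeries.coeff 0 (lossSeries π m 1) < 1) (r : ℕ) :
    lossSeries π (m + 1) r =
      PowerSeries.C (π.real {r}) + lossSeries π m (r + 1) * passageSeries π (m + 1) := by
  rw [passageSeries_succ_eq h, lossSeries]

section Bounds

variable (π c : Measure ℕ) [IsProbabilityMeasure π] [IsProbabilityMeasure c]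
  {a b : ℝ} (ha : 0 ≤ a) (ha' : a ≤ 1) (hb : 0 < b) (hb' : b ≤ 1)

/-- Bounds for the losses during a passage, with coefficientwise comparison of partial sums. -/
theorem lossSeries_bounds (hπ : π.real {0} = b) (hc : c.real {0} = a)
    (hnbu : ∀ r m, π.real (Set.Ici (r + m)) ≤ π.real (Set.Ici r) * π.real (Set.Ici m))
    (hmin : ∀ r m, π.real (Set.Ici r) * c.real (Set.Ici m) ≤ π.real (Set.Ici (r + m))) (m : ℕ) :
    (∀ r, CoeffNonneg (lossSeries π m r)) ∧
    (∀ r, CoeffNonneg ((lossSeries π m r - PowerSeries.C (π.real (Set.Ici r)) *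
      massSeries ((randomSum (delayedGeometric b b hb.le hb' hb hb').toMeasure)^[m] π)) *
        onesSeries)) ∧
    (∀ r, CoeffNonneg ((PowerSeries.C (π.real (Set.Ici r)) *
      massSeries ((randomSum (delayedGeometric a b ha ha' hb hb').toMeasure)^[m] c) -
        lossSeries π m r) * onesSeries)) ∧
    PowerSeries.coeff 0 (lossSeries π m 1) < 1 := by
  have hT1 : π.real (Set.Ici 1) = 1 - b := by
    have := measureReal_singleton_eq_sub π 0
    rw [measureReal_Ici_zero, hπ] at this
    simp only [zero_add] at this
    linarith
  have hC1 : c.real (Set.Ici 1) = 1 - a := by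
    have := measureReal_singleton_eq_sub c 0
    rw [measureReal_Ici_zero, hc] at this
    simp only [zero_add] at this
    linarith
  -- The lower stochastic bound caps the constant coefficient by `1 - b < 1`, which makes the
  -- geometric series at the next level legitimate.
  have hlt : ∀ (f : PowerSeries ℝ) (μ : Measure ℕ) [IsProbabilityMeasure μ],
      CoeffNonneg ((PowerSeries.C (π.real (Set.Ici 1)) * massSeries μ - f) * onesSeries) →
      PowerSeries.coeff 0 f < 1 := by
    intro f μ _ h
    have h0 := h 0
    rw [coeff_mul_onesSeries] at h0
    simp only [zero_add, Finset.range_one, Finset.sum_singleton] at h0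
    rw [map_sub, PowerSeries.coeff_C_mul, coeff_massSeries, hT1] at h0
    have := measureReal_le_one (μ := μ) (s := {0})
    nlinarith
  induction m with
  | zero =>
    -- With no room left every further arrival is lost, so both bounds are the tail inequalities
    -- `hmin` and `hnbu` themselves.
    have h3 : ∀ r, CoeffNonneg ((PowerSeries.C (π.real (Set.Ici r)) * massSeries c -
        lossSeries π 0 r) * onesSeries) := by
      intro r i
      rw [sub_mul, mul_assoc, map_sub, PowerSeries.coeff_C_mul, coeff_massSeries_mul_onesSeries,
        coeff_mul_onesSeries]
      simp only [lossSeries, tailSeries, PowerSeries.coeff_mk]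
      rw [sum_measureReal_singleton_add]
      linarith [hmin r (i + 1)]
    refine ⟨fun r i => ?_, fun r i => ?_, h3, hlt _ _ (h3 1)⟩
    · simp [lossSeries, tailSeries]
    · rw [sub_mul, mul_assoc, map_sub, PowerSeries.coeff_C_mul, Function.iterate_zero, id,
        coeff_massSeries_mul_onesSeries, coeff_mul_onesSeries]
      simp only [lossSeries, tailSeries, PowerSeries.coeff_mk]
      rw [sum_measureReal_singleton_add]
      linarith [hnbu r (i + 1)]
  | succ m ih =>
    obtain ⟨ih1, ih2, ih3, ih4⟩ := ih
    have hD : CoeffNonneg (passageSeries π (m + 1)) := by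
      rw [passageSeries_succ_eq ih4]
      exact (coeffNonneg_C measureReal_nonneg).mul ((ih1 1).inv_one_sub ih4)
    have hF := lossSeries_succ ih4
    have hDD := hF 0
    rw [← passageSeries, hπ, zero_add] at hDD
    rw [Function.iterate_succ_apply', Function.iterate_succ_apply']
    set U := (randomSum (delayedGeometric b b hb.le hb' hb hb').toMeasure)^[m] π
    set V := (randomSum (delayedGeometric a b ha ha' hb hb').toMeasure)^[m] c
    have hUs := massSeries_randomSum_delayedGeometric hb.le hb' hb hb' U
    have hWs := massSeries_randomSum_delayedGeometric hb.le hb' hb hb' V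
    have hVs := massSeries_randomSum_delayedGeometric ha ha' hb hb' V
    have hUc := massSeries_conv U (randomSum (delayedGeometric b b hb.le hb' hb hb').toMeasure U)
    have hVc := massSeries_conv V (randomSum (delayedGeometric b b hb.le hb' hb hb').toMeasure V)
    set U' := randomSum (delayedGeometric b b hb.le hb' hb hb').toMeasure U
    set W := randomSum (delayedGeometric b b hb.le hb' hb hb').toMeasure V
    set V' := randomSum (delayedGeometric a b ha ha' hb hb').toMeasure V
    set D := passageSeries π (m + 1)
    have hr : ∀ r, π.real {r} = π.real (Set.Ici r) - π.real (Set.Ici (r + 1)) :=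
      measureReal_singleton_eq_sub π
    -- Write `F` for `lossSeries π m 1`. From `(1 - F) D = b` and `(1 - (1 - b) U) U' = b` follows
    -- `b (D - U') = (F - (1 - b) U) U' D`. The first factor on the right is controlled by
    -- induction.
    have hDU : CoeffNonneg ((D - massSeries U') * onesSeries) := by
      refine CoeffNonneg.of_C_mul hb ?_
      have := ((ih2 1).mul (coeffNonneg_massSeries U')).mul hD
      rw [hT1] at this
      convert this using 1
      linear_combination (massSeries U' * onesSeries) * hDD - (D * onesSeries) * hUs
    have hWD : CoeffNonneg ((massSeries W - D) * onesSeries) := by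
      refine CoeffNonneg.of_C_mul hb ?_
      have := ((ih3 1).mul (coeffNonneg_massSeries W)).mul hD
      rw [hT1] at this
      convert this using 1
      linear_combination -(massSeries W * onesSeries) * hDD + (D * onesSeries) * hWs
    have h3 : ∀ r, CoeffNonneg ((PowerSeries.C (π.real (Set.Ici r)) * massSeries V' -
        lossSeries π (m + 1) r) * onesSeries) := by
      intro r
      -- The difference splits into three parts: replacing the excursion by `V`, replacing the
      -- following passage by `W`, and raising the chance of another arrival above `1 - a`. The last
      -- one multiplies `1 - V W`, whose partial sums are tails.
      have hδ : 0 ≤ π.real (Set.Ici (r + 1)) - π.real (Set.Ici r) * (1 - a) := by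
        have := hmin r 1
        rw [hC1] at this
        linarith
      have h := (((ih3 (r + 1)).mul hD).add
        ((coeffNonneg_C (a := π.real (Set.Ici (r + 1))) measureReal_nonneg).mul
          ((coeffNonneg_massSeries V).mul hWD))).add
        ((coeffNonneg_C hδ).mul (coeffNonneg_one_sub_massSeries_mul_onesSeries (V.conv W)))
      convert h using 1
      rw [hVc, hF r, hr r, hVs]
      simp only [map_sub, map_mul, map_one]
      ring
    refine ⟨fun r => ?_, fun r => ?_, h3, hlt _ _ (h3 1)⟩
    · rw [hF r]
      exact (coeffNonneg_C measureReal_nonneg).add ((ih1 _).mul hD)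
    · have hδ : 0 ≤ π.real (Set.Ici r) * (1 - b) - π.real (Set.Ici (r + 1)) := by
        have := hnbu r 1
        rw [hT1] at this
        linarith
      have h := (((ih2 (r + 1)).mul hD).add
        ((coeffNonneg_C (a := π.real (Set.Ici (r + 1))) measureReal_nonneg).mul
          ((coeffNonneg_massSeries U).mul hDU))).add
        ((coeffNonneg_C hδ).mul (coeffNonneg_one_sub_massSeries_mul_onesSeries (U.conv U')))
      convert h using 1
      rw [hUc, hF r, hr r]
      simp only [map_sub, map_mul, map_one] at hUs ⊢
      linear_combination -(PowerSeries.C (π.real (Set.Ici r)) * onesSeries) * hUs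
end Bounds

/-! ### First-step analysis of the number of losses -/

/-- `numInSystem` with `q` instead of one customer in the system at time `0`. -/
def numInSystemFrom (n : ℕ) (a : ℕ → ℕ) (q : ℕ) : ℕ → ℕ
  | 0 => q
  | k + 1 => if numInSystemFrom n a q k = 0 then 0
      else min (numInSystemFrom n a q k + a k) (n + 1) - 1

theorem numInSystem_eq (n : ℕ) (a : ℕ → ℕ) (k : ℕ) :
    numInSystem n a k = numInSystemFrom n a 1 k := by
  induction k with
  | zero => rfl
  | succ k ih => rw [numInSystem, numInSystemFrom, ih]

theorem numInSystemFrom_succ (n : ℕ) (a : ℕ → ℕ) {q : ℕ} (hq : q ≠ 0) (k : ℕ) :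
    numInSystemFrom n a q (k + 1) =
      numInSystemFrom n (fun i => a (i + 1)) (min (q + a 0) (n + 1) - 1) k := by
  induction k with
  | zero => simp [numInSystemFrom, hq]
  | succ k ih => rw [numInSystemFrom, ih, numInSystemFrom]

theorem numInSystemFrom_eq_zero_of_le {n : ℕ} {a : ℕ → ℕ} {q k l : ℕ} (hkl : k ≤ l)
    (h : numInSystemFrom n a q k = 0) : numInSystemFrom n a q l = 0 := by
  induction l, hkl using Nat.le_induction with
  | base => exact h
  | succ l _ ih => rw [numInSystemFrom, if_pos ih]

/-- The number of losses during the `(k + 1)`-st service. -/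
def serviceLosses (n : ℕ) (a : ℕ → ℕ) (q k : ℕ) : ℕ :=
  if numInSystemFrom n a q k = 0 then 0 else a k - (n + 1 - numInSystemFrom n a q k)

/-- State `0` is absorbing and contributes no losses, so any horizon `K` beyond the end serves as
well as `numServices`. -/
theorem losses_eq_sum {n : ℕ} {a : ℕ → ℕ} {K : ℕ} (h : numInSystemFrom n a 1 K = 0) :
    losses n a = ∑ k ∈ Finset.range K, serviceLosses n a 1 k := by
  have hle : numServices n a ≤ K := by
    refine Nat.sInf_le ?_
    rw [Set.mem_ofPred_eq, numInSystem_eq, h]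
  have h0 : numInSystemFrom n a 1 (numServices n a) = 0 := by
    have : numServices n a ∈ {k | numInSystem n a k = 0} :=
      Nat.sInf_mem ⟨K, by rw [Set.mem_ofPred_eq, numInSystem_eq, h]⟩
    rwa [Set.mem_ofPred_eq, numInSystem_eq] at this
  rw [← Finset.sum_subset (Finset.range_mono hle), losses]
  · refine Finset.sum_congr rfl fun k hk => ?_
    have : numInSystem n a k ≠ 0 := fun h' =>
      Nat.notMem_of_lt_sInf (Finset.mem_range.mp hk) h'
    rw [numInSystem_eq] at this ⊢
    rw [serviceLosses, if_neg this]
  · intro k _ hk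
    rw [Finset.mem_range, not_lt] at hk
    rw [serviceLosses, if_pos (numInSystemFrom_eq_zero_of_le hk h0)]

/-- The event that the system becomes empty and that `l` customers are lost until then, if there
are `q` customers at time `0`. -/
def lossEvent (n q l : ℕ) : Set (ℕ → ℕ) :=
  {a | ∃ K, numInSystemFrom n a q K = 0 ∧ ∑ k ∈ Finset.range K, serviceLosses n a q k = l}

theorem numInSystemFrom_zero (n : ℕ) (a : ℕ → ℕ) (k : ℕ) : numInSystemFrom n a 0 k = 0 :=
  numInSystemFrom_eq_zero_of_le (Nat.zero_le k) rfl

theorem lossEvent_zero (n l : ℕ) : lossEvent n 0 l = if l = 0 then Set.univ else ∅ := by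
  ext a
  simp only [lossEvent, numInSystemFrom_zero, serviceLosses, Set.mem_ofPred_eq, if_true,
    Finset.sum_const_zero, true_and, exists_const]
  split_ifs with h <;> simp [h, eq_comm]

/-- Decomposition by the first service. The inequality is needed because the subtraction from `l` is
truncated. -/
theorem mem_lossEvent_iff (n : ℕ) {q : ℕ} (hq : q ≠ 0) (l : ℕ) (a : ℕ → ℕ) :
    a ∈ lossEvent n q l ↔ a 0 - (n + 1 - q) ≤ l ∧
      (fun i => a (i + 1)) ∈
        lossEvent n (min (q + a 0) (n + 1) - 1) (l - (a 0 - (n + 1 - q))) := by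
  have hs : ∀ k, serviceLosses n a q (k + 1) =
      serviceLosses n (fun i => a (i + 1)) (min (q + a 0) (n + 1) - 1) k := fun k => by
    rw [serviceLosses, serviceLosses, numInSystemFrom_succ n a hq]
  have h0 : serviceLosses n a q 0 = a 0 - (n + 1 - q) := by
    simp [serviceLosses, numInSystemFrom, hq]
  constructor
  · rintro ⟨K, hK, hl⟩
    cases K with
    | zero => exact absurd hK hq
    | succ K =>
      rw [Finset.sum_range_succ', h0] at hl
      simp_rw [hs] at hl
      exact ⟨by omega, K, by rwa [← numInSystemFrom_succ n a hq], by omega⟩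
  · rintro ⟨hle, K, hK, hl⟩
    refine ⟨K + 1, by rwa [numInSystemFrom_succ n a hq], ?_⟩
    rw [Finset.sum_range_succ', h0]
    simp_rw [hs]
    omega

theorem measurable_numInSystemFrom (n q k : ℕ) :
    Measurable fun a : ℕ → ℕ => numInSystemFrom n a q k := by
  induction k with
  | zero => exact measurable_const
  | succ k ih =>
    exact (measurable_of_countable fun x : ℕ × ℕ =>
      if x.1 = 0 then 0 else min (x.1 + x.2) (n + 1) - 1).comp (ih.prodMk (measurable_pi_apply k))

theorem measurableSet_lossEvent (n q l : ℕ) : MeasurableSet (lossEvent n q l) := by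
  have hs : ∀ k, Measurable fun a : ℕ → ℕ => serviceLosses n a q k := fun k =>
    (measurable_of_countable fun x : ℕ × ℕ =>
      if x.1 = 0 then 0 else x.2 - (n + 1 - x.1)).comp
        ((measurable_numInSystemFrom n q k).prodMk (measurable_pi_apply k))
  have : lossEvent n q l = ⋃ K, {a | numInSystemFrom n a q K = 0} ∩
      {a | ∑ k ∈ Finset.range K, serviceLosses n a q k = l} := by
    ext a; simp [lossEvent]
  rw [this]
  refine MeasurableSet.iUnion fun K => MeasurableSet.inter ?_ ?_
  · exact measurable_numInSystemFrom n q K (measurableSet_singleton 0)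
  · exact (Finset.measurable_fun_sum _ fun k _ => hs k) (measurableSet_singleton l)

/-! ### Product measures and the first-step equation -/

/-- A measure on sequences is the product measure as soon as it is right on boxes that restrict an
initial segment of the coordinates. -/
theorem eq_infinitePi_of_range {X : Type*} [MeasurableSpace X] {π : Measure X}
    [IsProbabilityMeasure π] {ν : Measure (ℕ → X)}
    (h : ∀ (K : ℕ) (t : ℕ → Set X), (∀ i, MeasurableSet (t i)) →
      ν {a | ∀ k < K, a k ∈ t k} = ∏ k ∈ Finset.range K, π (t k)) :
    ν = Measure.infinitePi fun _ => π := by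
  classical
  refine Measure.eq_infinitePi _ fun s t ht => ?_
  obtain ⟨K, hK⟩ := s.exists_nat_subset_range
  have h1 := h K (fun i => if i ∈ s then t i else Set.univ) (fun i => by
    split_ifs
    · exact ht i
    · exact MeasurableSet.univ)
  have h2 : {a : ℕ → X | ∀ k < K, a k ∈ if k ∈ s then t k else Set.univ} = (s : Set ℕ).pi t := by
    ext a
    simp only [Set.mem_ofPred_eq, Set.mem_pi, Finset.mem_coe]
    refine ⟨fun h i hi => ?_, fun h i _ => ?_⟩
    · simpa [hi] using h i (Finset.mem_range.mp (hK hi))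
    · split_ifs with hi
      · exact h i hi
      · trivial
  rw [h2] at h1
  rw [h1, ← Finset.prod_subset hK]
  · exact Finset.prod_congr rfl fun i hi => by rw [if_pos hi]
  · intro i _ hi
    rw [if_neg hi, measure_univ]

/-- The sequence with first term `x.1` and further terms `x.2`. -/
def consSeq {X : Type*} (x : X × (ℕ → X)) : ℕ → X
  | 0 => x.1
  | i + 1 => x.2 i

theorem measurable_consSeq {X : Type*} [MeasurableSpace X] :
    Measurable (consSeq : X × (ℕ → X) → ℕ → X) := by
  refine measurable_pi_lambda _ fun i => ?_
  cases i with
  | zero => exact measurable_fst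
  | succ i => exact (measurable_pi_apply i).comp measurable_snd

theorem map_consSeq_infinitePi {X : Type*} [MeasurableSpace X] (π : Measure X)
    [IsProbabilityMeasure π] :
    (π.prod (Measure.infinitePi fun _ : ℕ => π)).map consSeq = Measure.infinitePi fun _ => π := by
  refine eq_infinitePi_of_range fun K t ht => ?_
  have hm : MeasurableSet {a : ℕ → X | ∀ k < K, a k ∈ t k} := by
    have : {a : ℕ → X | ∀ k < K, a k ∈ t k} = (Finset.range K : Set ℕ).pi t := by
      ext a; simp
    rw [this]
    exact MeasurableSet.pi (Finset.countable_toSet _) fun i _ => ht i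
  rw [Measure.map_apply measurable_consSeq hm]
  cases K with
  | zero => simp
  | succ K =>
    have : consSeq ⁻¹' {a : ℕ → X | ∀ k < K + 1, a k ∈ t k} =
        t 0 ×ˢ ((Finset.range K : Set ℕ).pi fun i => t (i + 1)) := by
      ext x
      simp only [Set.mem_preimage, Set.mem_ofPred_eq, Nat.forall_lt_succ_left', Set.mem_prod,
        Set.mem_pi, Finset.coe_range, Set.mem_Iio]
      rfl
    rw [this, Measure.prod_prod, Measure.infinitePi_pi _ fun i _ => ht (i + 1),
      Finset.prod_range_succ', mul_comm]

/-- First-step equation for the law of the number of losses. -/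
theorem measureReal_lossEvent (π : Measure ℕ) [IsProbabilityMeasure π] (n : ℕ) {q : ℕ}
    (hq : q ≠ 0) (l : ℕ) :
    (Measure.infinitePi fun _ : ℕ => π).real (lossEvent n q l) =
      ∑ x ∈ Finset.range (n + 1 - q + l + 1), π.real {x} *
        (Measure.infinitePi fun _ : ℕ => π).real
          (lossEvent n (min (q + x) (n + 1) - 1) (l - (x - (n + 1 - q)))) := by
  set Q := Measure.infinitePi fun _ : ℕ => π with hQ
  -- A first service with at most `l` losses has at most `n + 1 - q` admitted and `l` lost arrivals,
  -- so the union is finite.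
  have h1 : consSeq ⁻¹' lossEvent n q l = ⋃ x ∈ Finset.range (n + 1 - q + l + 1),
      {x} ×ˢ lossEvent n (min (q + x) (n + 1) - 1) (l - (x - (n + 1 - q))) := by
    ext ⟨x, f⟩
    simp only [Set.mem_preimage, mem_lossEvent_iff n hq, Set.mem_iUnion, Set.mem_prod,
      Set.mem_singleton_iff, Finset.mem_range, exists_prop]
    constructor
    · rintro ⟨h, h'⟩
      change x - (n + 1 - q) ≤ l at h
      exact ⟨x, by omega, rfl, h'⟩
    · rintro ⟨_, h, rfl, h'⟩
      exact ⟨show x - (n + 1 - q) ≤ l by omega, h'⟩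
  conv_lhs => rw [hQ, ← map_consSeq_infinitePi π]
  rw [map_measureReal_apply measurable_consSeq (measurableSet_lossEvent n q l), h1,
    measureReal_biUnion_finset]
  · refine Finset.sum_congr rfl fun x _ => ?_
    rw [measureReal_prod_prod]
  · intro x _ y _ hxy
    exact Set.disjoint_left.mpr fun z hz hz' => hxy (hz.1.symm.trans hz'.1)
  · exact fun x _ => (measurableSet_singleton x).prod (measurableSet_lossEvent _ _ _)

/-- Uniqueness for the first-step equation. -/
theorem firstStep_unique (π : Measure ℕ) [IsProbabilityMeasure π] (hπ : 0 < π.real {0}) (n : ℕ)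
    {f g : ℕ → ℕ → ℝ} (h0 : ∀ l, f 0 l = g 0 l)
    (hf : ∀ q l, q ≠ 0 → q ≤ n + 1 → f q l = ∑ x ∈ Finset.range (n + 1 - q + l + 1), π.real {x} *
      f (min (q + x) (n + 1) - 1) (l - (x - (n + 1 - q))))
    (hg : ∀ q l, q ≠ 0 → q ≤ n + 1 → g q l = ∑ x ∈ Finset.range (n + 1 - q + l + 1), π.real {x} *
      g (min (q + x) (n + 1) - 1) (l - (x - (n + 1 - q))))
    {q : ℕ} (hq : q ≤ n + 1) (l : ℕ) : f q l = g q l := by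
  set b := π.real {0} with hb
  -- The equation leads from `(q, l)` only to states at most `n + 1` and loss counts at most `l`, so
  -- a finite rectangle is closed under it.
  obtain ⟨z, hz, hmax⟩ := Finset.exists_max_image
    (Finset.range (n + 2) ×ˢ Finset.range (l + 1)) (fun z => |f z.1 z.2 - g z.1 z.2|)
    ⟨(0, 0), by simp⟩
  set M := |f z.1 z.2 - g z.1 z.2| with hM
  have hM0 : 0 ≤ M := abs_nonneg _
  have hle : ∀ q l', q ≤ n + 1 → l' ≤ l → |f q l' - g q l'| ≤ M := fun q l' h h' =>
    hmax (q, l') (by simp; omega)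
  have hb1 : b ≤ 1 := measureReal_le_one
  -- With probability `b ^ q`, `q` services without arrivals lead to state `0`, where `f` and `g`
  -- agree. At the maximising point this gives `M ≤ M (1 - b ^ q)`, hence `M = 0`.
  have key : ∀ q, q ≤ n + 1 → ∀ l' ≤ l, |f q l' - g q l'| ≤ M * (1 - b ^ q) := by
    intro q
    induction q with
    | zero => intro _ l' _; simp [h0]
    | succ q ih =>
      intro hq l' hl'
      rw [hf _ _ (Nat.succ_ne_zero q) hq, hg _ _ (Nat.succ_ne_zero q) hq, ← Finset.sum_sub_distrib]
      simp_rw [← mul_sub]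
      rw [Finset.sum_range_succ']
      refine (abs_add_le _ _).trans ?_
      have h1 : |π.real {0} * (f (min (q + 1 + 0) (n + 1) - 1) (l' - (0 - (n + 1 - (q + 1)))) -
          g (min (q + 1 + 0) (n + 1) - 1) (l' - (0 - (n + 1 - (q + 1)))))| ≤
          b * (M * (1 - b ^ q)) := by
        have e1 : min (q + 1 + 0) (n + 1) - 1 = q := by omega
        have e2 : l' - (0 - (n + 1 - (q + 1))) = l' := by omega
        rw [e1, e2, abs_mul, abs_of_pos hπ]
        exact mul_le_mul_of_nonneg_left (ih (by omega) l' hl') hπ.le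
      have h2 : ∑ x ∈ Finset.range (n + 1 - (q + 1) + l'), π.real {x + 1} ≤ 1 - b := by
        have := sum_measureReal_singleton_add π 1 (n + 1 - (q + 1) + l')
        simp_rw [add_comm 1] at this
        rw [this, hb, measureReal_singleton_eq_sub, measureReal_Ici_zero, zero_add]
        linarith [measureReal_nonneg (μ := π) (s := Set.Ici (n + 1 - (q + 1) + l' + 1))]
      refine (add_le_add ((Finset.abs_sum_le_sum_abs _ _).trans (Finset.sum_le_sum
        (g := fun x => π.real {x + 1} * M) fun x _ => ?_)) h1).trans ?_
      · rw [abs_mul, abs_of_nonneg measureReal_nonneg]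
        exact mul_le_mul_of_nonneg_left (hle _ _ (by omega) (by omega)) measureReal_nonneg
      · rw [← Finset.sum_mul, pow_succ]
        nlinarith
  have hzM := key z.1 (by simp at hz; omega) z.2 (by simp at hz; omega)
  have hpow : 0 < b ^ z.1 := pow_pos hπ _
  have hM1 : M = 0 := by nlinarith
  have := hle q l hq le_rfl
  rw [hM1] at this
  exact sub_eq_zero.mp (abs_eq_zero.mp (le_antisymm this (abs_nonneg _)))

/-! ### Solving the first-step equation by passage series -/

/-- Generating series of the number of losses until the system is empty, if there are `q`
customers at time `0`. -/
def totalLossSeries (π : Measure ℕ) (n q : ℕ) : PowerSeries ℝ :=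
  ∏ j ∈ Finset.range q, passageSeries π (n - j)

/-- Unfolds the `m` free places one at a time: `i < m` further arrivals are all admitted and leave
state `n - m + i`; from `m` on the surplus is lost and the state is `n`. With `r = 0` this is the
first-step equation. -/
theorem lossSeries_mul_totalLossSeries {π : Measure ℕ}
    (h : ∀ m, PowerSeries.coeff 0 (lossSeries π m 1) < 1) (n m r : ℕ) (hm : m ≤ n) :
    lossSeries π m r * totalLossSeries π n (n - m) =
      ∑ i ∈ Finset.range m, PowerSeries.C (π.real {r + i}) * totalLossSeries π n (n - m + i) +
        tailSeries π (r + m) * totalLossSeries π n n := by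
  induction m generalizing r with
  | zero => simp [lossSeries]
  | succ m ih =>
    have h1 : n - m = n - (m + 1) + 1 := by omega
    have h2 : totalLossSeries π n (n - m) =
        totalLossSeries π n (n - (m + 1)) * passageSeries π (m + 1) := by
      rw [h1, totalLossSeries, Finset.prod_range_succ, ← totalLossSeries]
      congr 2
      omega
    have h3 := ih (r + 1) (by omega)
    rw [lossSeries_succ (h m), Finset.sum_range_succ', add_mul, mul_assoc,
      mul_comm (passageSeries π (m + 1)), ← h2, h3, add_zero, add_zero, add_right_comm r 1 m,
      ← add_assoc r m 1]
    have h4 : ∀ i, π.real {r + (i + 1)} = π.real {r + 1 + i} := fun i => by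
      rw [add_assoc, add_comm 1]
    have h5 : ∀ i, n - (m + 1) + (i + 1) = n - m + i := fun i => by omega
    simp_rw [h4, h5]
    ring

theorem coeff_totalLossSeries {π : Measure ℕ}
    (h : ∀ m, PowerSeries.coeff 0 (lossSeries π m 1) < 1) (n q l : ℕ) (hq : q ≠ 0)
    (hqn : q ≤ n + 1) :
    PowerSeries.coeff l (totalLossSeries π n q) =
      ∑ x ∈ Finset.range (n + 1 - q + l + 1), π.real {x} *
        PowerSeries.coeff (l - (x - (n + 1 - q)))
          (totalLossSeries π n (min (q + x) (n + 1) - 1)) := by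
  obtain ⟨m, hm, rfl⟩ : ∃ m, m ≤ n ∧ q = n - m + 1 := ⟨n + 1 - q, by omega, by omega⟩
  have e : n + 1 - (n - m + 1) = m := by omega
  have h1 : totalLossSeries π n (n - m + 1) = lossSeries π m 0 * totalLossSeries π n (n - m) := by
    rw [totalLossSeries, Finset.prod_range_succ, mul_comm, ← totalLossSeries, passageSeries]
    congr 2
    omega
  rw [e, h1, lossSeries_mul_totalLossSeries h n m 0 hm, map_add, map_sum, add_assoc,
    Finset.sum_range_add]
  congr 1
  · refine Finset.sum_congr rfl fun i hi => ?_
    rw [Finset.mem_range] at hi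
    have e1 : min (n - m + 1 + i) (n + 1) - 1 = n - m + i := by omega
    have e2 : l - (i - m) = l := by omega
    rw [PowerSeries.coeff_C_mul, e1, e2, zero_add]
  · rw [PowerSeries.coeff_mul, Finset.Nat.sum_antidiagonal_eq_sum_range_succ_mk]
    refine Finset.sum_congr rfl fun i _ => ?_
    have e1 : min (n - m + 1 + (m + i)) (n + 1) - 1 = n := by omega
    have e2 : l - (m + i - m) = l - i := by omega
    rw [e1, e2, zero_add, tailSeries, PowerSeries.coeff_mk]

theorem measureReal_lossEvent_one {π : Measure ℕ} [IsProbabilityMeasure π]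
    (hπ : 0 < π.real {0}) (h : ∀ m, PowerSeries.coeff 0 (lossSeries π m 1) < 1) (n l : ℕ) :
    (Measure.infinitePi fun _ : ℕ => π).real (lossEvent n 1 l) =
      PowerSeries.coeff l (passageSeries π n) := by
  have := firstStep_unique π hπ n
    (f := fun q l => (Measure.infinitePi fun _ : ℕ => π).real (lossEvent n q l))
    (g := fun q l => PowerSeries.coeff l (totalLossSeries π n q))
    (fun l => by
      simp only [lossEvent_zero, totalLossSeries, Finset.range_zero, Finset.prod_empty,
        PowerSeries.coeff_one]
      split_ifs <;> simp)
    (fun q l hq _ => measureReal_lossEvent π n hq l)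
    (fun q l hq hqn => coeff_totalLossSeries h n q l hq hqn) (q := 1) (by omega) l
  simpa [totalLossSeries] using this

theorem losses_eq_of_mem_lossEvent {n l : ℕ} {a : ℕ → ℕ} (h : a ∈ lossEvent n 1 l) :
    losses n a = l := by
  obtain ⟨K, hK, hl⟩ := h
  rw [losses_eq_sum hK, hl]

/-- If the system never empties, `numServices` is the infimum of the empty set, which is `0`. -/
theorem losses_eq_zero_of_notMem_lossEvent {n : ℕ} {a : ℕ → ℕ}
    (h : ∀ l, a ∉ lossEvent n 1 l) : losses n a = 0 := by
  have : {k | numInSystem n a k = 0} = ∅ := by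
    rw [Set.eq_empty_iff_forall_notMem]
    intro K hK
    rw [Set.mem_ofPred_eq, numInSystem_eq] at hK
    exact h _ ⟨K, hK, rfl⟩
  simp [losses, numServices, this]

theorem measurable_losses (n : ℕ) : Measurable (losses n) := by
  refine measurable_to_countable' fun l => ?_
  have : losses n ⁻¹' {l} = lossEvent n 1 l ∪
      ((⋃ l, lossEvent n 1 l)ᶜ ∩ {_a : ℕ → ℕ | l = 0}) := by
    ext a
    simp only [Set.mem_preimage, Set.mem_singleton_iff, Set.mem_union, Set.mem_inter_iff,
      Set.mem_compl_iff, Set.mem_iUnion, not_exists, Set.mem_ofPred_eq]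
    constructor
    · intro h
      by_cases hl : ∃ l', a ∈ lossEvent n 1 l'
      · obtain ⟨l', hl'⟩ := hl
        rw [losses_eq_of_mem_lossEvent hl'] at h
        exact Or.inl (h ▸ hl')
      · push Not at hl
        exact Or.inr ⟨hl, by rw [← h, losses_eq_zero_of_notMem_lossEvent hl]⟩
    · rintro (h | ⟨h, rfl⟩)
      · exact losses_eq_of_mem_lossEvent h
      · exact losses_eq_zero_of_notMem_lossEvent h
  rw [this]
  exact (measurableSet_lossEvent n 1 l).union
    ((MeasurableSet.iUnion fun l => measurableSet_lossEvent n 1 l).compl.inter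
      (MeasurableSet.const _))

/-! ### Stochastic bounds for the losses -/

theorem tendsto_measureReal_Ici (μ : Measure ℕ) [IsProbabilityMeasure μ] :
    Filter.Tendsto (fun i => μ.real (Set.Ici i)) Filter.atTop (nhds 0) := by
  have h := (hasSum_measureReal_singleton μ).tendsto_sum_nat.const_sub 1
  rw [sub_self] at h
  refine h.congr fun i => ?_
  have := sum_measureReal_singleton_add μ 0 i
  simp only [zero_add] at this
  rw [this, measureReal_Ici_zero]
  ring

theorem stLe_iff {μ ν : Measure ℕ} [IsProbabilityMeasure μ] [IsProbabilityMeasure ν] :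
    StLe μ ν ↔ ∀ m, μ.real (Set.Ici m) ≤ ν.real (Set.Ici m) :=
  forall_congr' fun _ => (ENNReal.toReal_le_toReal (measure_ne_top _ _) (measure_ne_top _ _)).symm

/-- Two-sided bound for the number of losses if the numbers of arrivals per service are i.i.d.
with law `π`. -/
theorem stLe_map_losses (π c : Measure ℕ) [IsProbabilityMeasure π] [IsProbabilityMeasure c]
    {a b : ℝ} (ha : 0 ≤ a) (ha' : a ≤ 1) (hb : 0 < b) (hb' : b ≤ 1)
    (hπ : π.real {0} = b) (hc : c.real {0} = a)
    (hnbu : ∀ r m, π.real (Set.Ici (r + m)) ≤ π.real (Set.Ici r) * π.real (Set.Ici m))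
    (hmin : ∀ r m, π.real (Set.Ici r) * c.real (Set.Ici m) ≤ π.real (Set.Ici (r + m))) (n : ℕ) :
    StLe (randomSum (galtonWatson (delayedGeometric a b ha ha' hb hb') n) c)
        ((Measure.infinitePi fun _ : ℕ => π).map (losses n)) ∧
      StLe ((Measure.infinitePi fun _ : ℕ => π).map (losses n))
        (randomSum (galtonWatson (delayedGeometric b b hb.le hb' hb hb') n) π) := by
  rw [randomSum_galtonWatson, randomSum_galtonWatson]
  have hbd := lossSeries_bounds π c ha ha' hb hb' hπ hc hnbu hmin
  obtain ⟨-, hU, hV, -⟩ := hbd n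
  have hU := hU 0
  have hV := hV 0
  rw [measureReal_Ici_zero, map_one, one_mul, ← passageSeries] at hU hV
  set U := (randomSum (delayedGeometric b b hb.le hb' hb hb').toMeasure)^[n] π
  set V := (randomSum (delayedGeometric a b ha ha' hb hb').toMeasure)^[n] c
  have : IsProbabilityMeasure ((Measure.infinitePi fun _ : ℕ => π).map (losses n)) :=
    Measure.isProbabilityMeasure_map (measurable_losses n).aemeasurable
  set ρ := (Measure.infinitePi fun _ : ℕ => π).map (losses n) with hρ
  set d := fun l => PowerSeries.coeff l (passageSeries π n) with hd
  -- Only an inequality at this stage: a busy period that never ends counts as loss `0` in `ρ` but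
  -- is absent from `d`.
  have hdρ : ∀ l, d l ≤ ρ.real {l} := fun l => by
    rw [hd, hρ, map_measureReal_apply (measurable_losses n) (measurableSet_singleton l)]
    simp only
    rw [← measureReal_lossEvent_one (hπ ▸ hb) (fun m => (hbd m).2.2.2) n l]
    exact measureReal_mono fun a h => losses_eq_of_mem_lossEvent h
  have hU' : ∀ i, 1 - U.real (Set.Ici i) ≤ ∑ k ∈ Finset.range i, d k := fun i => by
    cases i with
    | zero => simp
    | succ i =>
      have := hU i
      rw [sub_mul, map_sub, coeff_massSeries_mul_onesSeries, coeff_mul_onesSeries] at this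
      linarith
  have hV' : ∀ i, ∑ k ∈ Finset.range i, d k ≤ 1 - V.real (Set.Ici i) := fun i => by
    cases i with
    | zero => simp
    | succ i =>
      have := hV i
      rw [sub_mul, map_sub, coeff_massSeries_mul_onesSeries, coeff_mul_onesSeries] at this
      linarith
  have hsum : ∀ i, ∑ k ∈ Finset.range i, ρ.real {k} = 1 - ρ.real (Set.Ici i) := fun i => by
    have := sum_measureReal_singleton_add ρ 0 i
    simpa only [zero_add, measureReal_Ici_zero] using this
  refine ⟨stLe_iff.mpr fun m => ?_, stLe_iff.mpr fun m => ?_⟩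
  -- The mass of `d` on `[m, m + i)` is at least `V[m, ∞) - U[m + i, ∞)`. As `i → ∞` the upper bound
  -- `U` rules out escaping mass, so almost sure finiteness of the busy period needs no separate
  -- proof.
  · refine ge_of_tendsto' (x := Filter.atTop)
      (((tendsto_measureReal_Ici U).comp (Filter.tendsto_add_atTop_nat m)).const_add
        (ρ.real (Set.Ici m))) (fun i => ?_) |>.trans (add_zero _).le
    have h1 : ∑ k ∈ Finset.range i, d (m + k) ≤ ∑ k ∈ Finset.range i, ρ.real {m + k} :=
      Finset.sum_le_sum fun k _ => hdρ _
    rw [sum_measureReal_singleton_add] at h1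
    have h2 := Finset.sum_range_add d m i
    have h3 := hU' (m + i)
    have h4 := hV' m
    have h5 : 0 ≤ ρ.real (Set.Ici (m + i)) := measureReal_nonneg
    simp only [Function.comp_apply, add_comm i m]
    linarith
  · have h1 := Finset.sum_le_sum fun k (_ : k ∈ Finset.range m) => hdρ k
    rw [hsum] at h1
    linarith [hU' m]

/-! ### Mixed Poisson laws -/

theorem measurable_poissonMeasure : Measurable poissonMeasure := by
  refine Measure.measurable_of_measurable_coe _ fun s hs => ?_
  have : (fun r => poissonMeasure r s) =
      fun r => ∑' k, s.indicator (fun k => poissonMeasure r {k}) k := by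
    funext r
    exact (Measure.tsum_indicator_apply_singleton _ s hs).symm
  rw [this]
  refine Measurable.tsum fun k => ?_
  by_cases hk : k ∈ s
  · simp only [Set.indicator_of_mem hk, poissonMeasure_singleton]
    fun_prop
  · simp only [Set.indicator_of_notMem hk]
    exact measurable_const

theorem measurable_poissonMeasure_mul_toNNReal (lam : ℝ≥0) :
    Measurable fun x : ℝ => poissonMeasure (lam * x.toNNReal) :=
  measurable_poissonMeasure.comp (by fun_prop)

/-- A mixed Poisson law is the mixture of Poisson laws over its mixing law. -/
theorem mixedPoisson_eq_bind (lam : ℝ≥0) (G : Measure ℝ) [IsFiniteMeasure G]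
    (hG : G (Set.Iio 0) = 0) :
    mixedPoisson lam G = G.bind fun x => poissonMeasure (lam * x.toNNReal) := by
  refine Measure.ext_of_singleton fun m => ?_
  rw [mixedPoisson, Measure.sum_smul_dirac_singleton,
    Measure.bind_apply (measurableSet_singleton m)
      (measurable_poissonMeasure_mul_toNNReal lam).aemeasurable]
  have hr : G.restrict (Set.Ici 0) = G :=
    Measure.restrict_eq_self_of_ae_mem (by
      rw [ae_iff]; convert hG using 2; ext x; simp)
  have hpos : ∀ᵐ x ∂G, 0 ≤ x := by
    rw [ae_iff]; convert hG using 2; ext x; simp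
  have hval : ∀ x : ℝ, 0 ≤ x → (poissonMeasure (lam * x.toNNReal)).real {m} =
      Real.exp (-(lam * x)) * (lam * x) ^ m / (m.factorial : ℝ) := by
    intro x hx
    rw [poissonMeasure_real_singleton, NNReal.coe_mul, Real.coe_toNNReal _ hx]
  rw [hr, ofReal_integral_eq_lintegral_ofReal]
  · refine lintegral_congr_ae (hpos.mono fun x hx => ?_)
    simp only
    rw [← hval x hx, ofReal_measureReal]
  · refine Integrable.of_bound (by fun_prop) 1 (hpos.mono fun x hx => ?_)
    rw [← hval x hx, Real.norm_of_nonneg measureReal_nonneg]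
    exact measureReal_le_one
  · refine hpos.mono fun x hx => ?_
    simp only [Pi.zero_apply]
    rw [← hval x hx]
    exact measureReal_nonneg

theorem mixedPoisson_apply (lam : ℝ≥0) (G : Measure ℝ) [IsFiniteMeasure G]
    (hG : G (Set.Iio 0) = 0) (s : Set ℕ) :
    mixedPoisson lam G s = ∫⁻ x, poissonMeasure (lam * x.toNNReal) s ∂G := by
  rw [mixedPoisson_eq_bind lam G hG, Measure.bind_apply (MeasurableSet.of_discrete)
    (measurable_poissonMeasure_mul_toNNReal lam).aemeasurable]

theorem isProbabilityMeasure_mixedPoisson (lam : ℝ≥0) (G : Measure ℝ) [IsProbabilityMeasure G]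
    (hG : G (Set.Iio 0) = 0) : IsProbabilityMeasure (mixedPoisson lam G) := by
  constructor
  rw [mixedPoisson_apply lam G hG]
  simp

/-! ### The numbers of arrivals per service -/

/-- Approximation of `t` from the right by multiples of `1 / (j + 1)`. -/
def rightApprox (j : ℕ) (t : ℝ≥0) : ℝ≥0 := (⌊t * (j + 1)⌋₊ + 1) / (j + 1)

theorem le_rightApprox (j : ℕ) (t : ℝ≥0) : t ≤ rightApprox j t := by
  rw [rightApprox, le_div_iff₀ (by positivity)]
  exact (Nat.lt_floor_add_one _).le

theorem rightApprox_le (j : ℕ) (t : ℝ≥0) : rightApprox j t ≤ t + 1 / (j + 1) := by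
  rw [rightApprox, div_le_iff₀ (by positivity), add_mul, div_mul_cancel₀ _ (by positivity)]
  gcongr
  exact Nat.floor_le (by positivity)

theorem tendsto_rightApprox (t : ℝ≥0) :
    Filter.Tendsto (fun j => rightApprox j t) Filter.atTop (nhdsWithin t (Set.Ici t)) := by
  refine tendsto_nhdsWithin_iff.mpr ⟨?_, Filter.Eventually.of_forall fun j => le_rightApprox j t⟩
  refine tendsto_of_tendsto_of_tendsto_of_le_of_le tendsto_const_nhds ?_
    (fun j => le_rightApprox j t) (fun j => rightApprox_le j t)
  have := (tendsto_one_div_add_atTop_nhds_zero_nat (𝕜 := ℝ≥0)).const_add t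
  simpa using this

theorem eventually_rightApprox_eq {c : ℝ≥0 → ℕ} {t : ℝ≥0}
    (hc : ContinuousWithinAt c (Set.Ici t) t) :
    ∀ᶠ j in Filter.atTop, c (rightApprox j t) = c t := by
  have h := hc.tendsto.comp (tendsto_rightApprox t)
  rw [nhds_discrete] at h
  exact Filter.tendsto_pure.mp h

/-- Evaluation of a path at a variable time is not jointly measurable for the product σ-algebra. The
approximate time takes only countably many values, which restores measurability. -/
theorem measurable_eval_rightApprox (j : ℕ) :
    Measurable fun z : (ℝ≥0 → ℕ) × ℝ≥0 => z.1 (rightApprox j z.2) := by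
  have h1 : Measurable fun z : (ℝ≥0 → ℕ) × ℕ => z.1 ((z.2 + 1) / (j + 1)) :=
    measurable_from_prod_countable_left fun k =>
      show Measurable fun f : ℝ≥0 → ℕ => f ((k + 1) / (j + 1)) from measurable_pi_apply _
  have h2 : Measurable fun z : (ℝ≥0 → ℕ) × ℝ≥0 => (z.1, ⌊z.2 * (j + 1)⌋₊) := by
    refine measurable_fst.prodMk (Nat.measurable_floor.comp (by fun_prop))
  exact h1.comp h2

theorem measurable_serviceEnd (k : ℕ) : Measurable fun s : ℕ → ℝ => serviceEnd s k := by
  unfold serviceEnd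
  fun_prop

/-- Arrivals during a service, computed with the right approximations of its ends. -/
def approxArrivals (j : ℕ) (z : (ℝ≥0 → ℕ) × (ℕ → ℝ)) (k : ℕ) : ℕ :=
  z.1 (rightApprox j (serviceEnd z.2 (k + 1))) - z.1 (rightApprox j (serviceEnd z.2 k))

theorem measurable_approxArrivals (j k : ℕ) : Measurable fun z => approxArrivals j z k := by
  have h : ∀ k, Measurable fun z : (ℝ≥0 → ℕ) × (ℕ → ℝ) =>
      z.1 (rightApprox j (serviceEnd z.2 k)) := fun k =>
    (measurable_eval_rightApprox j).comp
      (measurable_fst.prodMk ((measurable_serviceEnd k).comp measurable_snd))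
  exact (h (k + 1)).sub (h k)

theorem eventually_approxArrivals_eq {c : ℝ≥0 → ℕ}
    (hc : ∀ t, ContinuousWithinAt c (Set.Ici t) t) (s : ℕ → ℝ) (k : ℕ) :
    ∀ᶠ j in Filter.atTop, approxArrivals j (c, s) k = arrivals c s k := by
  filter_upwards [eventually_rightApprox_eq (hc (serviceEnd s (k + 1))),
    eventually_rightApprox_eq (hc (serviceEnd s k))] with j h1 h2
  simp only [approxArrivals, arrivals, h1, h2]

/-- The event that the approximate numbers of arrivals during the first `K` services are eventually
in the sets `t k`. -/
def arrivalsEvent (K : ℕ) (t : ℕ → Set ℕ) : Set ((ℝ≥0 → ℕ) × (ℕ → ℝ)) :=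
  {z | ∀ k < K, ∃ J, ∀ j ≥ J, approxArrivals j z k ∈ t k}

theorem measurableSet_arrivalsEvent (K : ℕ) (t : ℕ → Set ℕ) :
    MeasurableSet (arrivalsEvent K t) := by
  have : arrivalsEvent K t = ⋂ k, ⋂ (_ : k < K), ⋃ J, ⋂ j, ⋂ (_ : j ≥ J),
      (fun z => approxArrivals j z k) ⁻¹' t k := by
    ext z; simp [arrivalsEvent]
  rw [this]
  exact MeasurableSet.iInter fun k => MeasurableSet.iInter fun _ => MeasurableSet.iUnion fun J =>
    MeasurableSet.iInter fun j => MeasurableSet.iInter fun _ =>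
      measurable_approxArrivals j k MeasurableSet.of_discrete

theorem mem_arrivalsEvent_iff {c : ℝ≥0 → ℕ}
    (hc : ∀ t, ContinuousWithinAt c (Set.Ici t) t) (s : ℕ → ℝ) (K : ℕ) (t : ℕ → Set ℕ) :
    (c, s) ∈ arrivalsEvent K t ↔ ∀ k < K, arrivals c s k ∈ t k := by
  refine forall_congr' fun k => imp_congr_right fun _ => ?_
  obtain ⟨J, hJ⟩ := Filter.eventually_atTop.mp (eventually_approxArrivals_eq hc s k)
  constructor
  · rintro ⟨J', hJ'⟩
    rw [← hJ _ (le_max_left J J')]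
    exact hJ' _ (le_max_right J J')
  · intro h
    exact ⟨J, fun j hj => by rwa [hJ j hj]⟩

section Input

variable {Ω : Type*} [MeasurableSpace Ω] {P : Measure Ω} {lam : ℝ≥0}
  {B : Measure ℝ} {N : ℝ≥0 → Ω → ℕ} {S : ℕ → Ω → ℝ}

theorem IsQueueInput.measurable_arrivals (h : IsQueueInput lam B N S P) :
    Measurable fun ω => arrivals (fun t => N t ω) (fun k => S k ω) := by
  refine measurable_pi_lambda _ fun k => ?_
  refine measurable_of_tendsto_metrizable
    (f := fun j ω => approxArrivals j (fun t => N t ω, fun k => S k ω) k) (fun j => ?_) ?_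
  · exact (measurable_approxArrivals j k).comp
      ((measurable_pi_lambda _ h.poisson.measurable).prodMk
        (measurable_pi_lambda _ h.measurable_service))
  · refine tendsto_pi_nhds.mpr fun ω => ?_
    exact tendsto_nhds_of_eventually_eq
      (eventually_approxArrivals_eq (h.poisson.right_continuous ω) _ k)

/-- For given service times, the numbers of arrivals per service are independent Poisson
variables. -/
theorem IsPoissonProcess.measure_arrivals [IsProbabilityMeasure P] (h : IsPoissonProcess lam N P)
    {s : ℕ → ℝ}
    (hs : ∀ k, 0 ≤ s k) (K : ℕ) (t : ℕ → Set ℕ) :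
    P {ω | ∀ k < K, arrivals (fun t => N t ω) s k ∈ t k} =
      ∏ k ∈ Finset.range K, poissonMeasure (lam * (s k).toNNReal) (t k) := by
  have hsum : ∀ k, serviceEnd s (k + 1) = serviceEnd s k + (s k).toNNReal := fun k => by
    rw [serviceEnd, serviceEnd, Finset.sum_range_succ,
      Real.toNNReal_add (Finset.sum_nonneg fun i _ => hs i) (hs k)]
  have hmono : Monotone (serviceEnd s) := monotone_nat_of_le_succ fun k => by
    rw [hsum]; exact le_self_add
  have hind := h.indep_increments.nat hmono
  have := hind.measure_inter_preimage_eq_mul (Finset.range K) (sets := t)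
    fun i _ => MeasurableSet.of_discrete
  have hset : {ω | ∀ k < K, arrivals (fun t => N t ω) s k ∈ t k} =
      ⋂ i ∈ Finset.range K,
        (fun ω => N (serviceEnd s (i + 1)) ω - N (serviceEnd s i) ω) ⁻¹' t i := by
    ext ω; simp [arrivals]
  rw [hset, this]
  refine Finset.prod_congr rfl fun k _ => ?_
  have hl := h.increment_law (serviceEnd s k) (serviceEnd s (k + 1)) (hmono k.le_succ)
  rw [hsum, add_tsub_cancel_left, ← hsum] at hl
  rw [← hl, Measure.map_apply (by
    exact (h.measurable _).sub (h.measurable _)) MeasurableSet.of_discrete]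

/-- The numbers of arrivals per service are i.i.d. with the mixed Poisson law. -/
theorem IsQueueInput.map_arrivals [IsProbabilityMeasure P] [IsProbabilityMeasure B]
    (h : IsQueueInput lam B N S P) (hB : B (Set.Iio 0) = 0) :
    P.map (fun ω => arrivals (fun t => N t ω) (fun k => S k ω)) =
      Measure.infinitePi fun _ => mixedPoisson lam B := by
  have := isProbabilityMeasure_mixedPoisson lam B hB
  refine eq_infinitePi_of_range fun K t ht => ?_
  have hN : Measurable fun ω t => N t ω := measurable_pi_lambda _ h.poisson.measurable
  have hS : Measurable fun ω k => S k ω := measurable_pi_lambda _ h.measurable_service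
  have hm : MeasurableSet {a : ℕ → ℕ | ∀ k < K, a k ∈ t k} := by
    have : {a : ℕ → ℕ | ∀ k < K, a k ∈ t k} = (Finset.range K : Set ℕ).pi t := by
      ext a; simp
    rw [this]
    exact MeasurableSet.pi (Finset.countable_toSet _) fun i _ => ht i
  have hpos : ∀ᵐ ω ∂P, ∀ k, 0 ≤ S k ω := by
    refine ae_all_iff.mpr fun k => ?_
    have : ∀ᵐ x ∂(P.map (S k)), 0 ≤ x := by
      rw [h.service_law k, ae_iff]; convert hB using 2; ext x; simp
    exact ae_of_ae_map (h.measurable_service k).aemeasurable this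
  have hE := measurableSet_arrivalsEvent K t
  -- On right-continuous paths the event agrees with a measurable set of the product space, so
  -- independence and Fubini allow the service times to be frozen.
  have hset : (fun ω => arrivals (fun t => N t ω) (fun k => S k ω)) ⁻¹'
      {a : ℕ → ℕ | ∀ k < K, a k ∈ t k} =
      (fun ω => (fun t => N t ω, fun k => S k ω)) ⁻¹' arrivalsEvent K t := by
    ext ω
    exact (mem_arrivalsEvent_iff (h.poisson.right_continuous ω) _ K t).symm
  rw [Measure.map_apply h.measurable_arrivals hm, hset, ← Measure.map_apply (hN.prodMk hS) hE,
    h.indep_arrivals_service.map_prod_eq_prod_map_map hN.aemeasurable hS.aemeasurable]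
  have := Measure.isProbabilityMeasure_map (μ := P) hN.aemeasurable
  have := Measure.isProbabilityMeasure_map (μ := P) hS.aemeasurable
  rw [Measure.prod_apply_symm hE, lintegral_map (measurable_measure_prodMk_right hE) hS]
  have h1 : ∀ᵐ ω ∂P, (P.map fun ω t => N t ω)
      ((fun c => (c, fun k => S k ω)) ⁻¹' arrivalsEvent K t) =
      ∏ k ∈ Finset.range K, poissonMeasure (lam * (S k ω).toNNReal) (t k) := by
    refine hpos.mono fun ω hω => ?_
    rw [Measure.map_apply hN (measurable_prodMk_right hE), ← h.poisson.measure_arrivals hω]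
    congr 1
    ext ω'
    exact mem_arrivalsEvent_iff (h.poisson.right_continuous ω') _ K t
  have hmt : ∀ k, Measurable fun x : ℝ => poissonMeasure (lam * x.toNNReal) (t k) := fun k =>
    (Measure.measurable_coe (ht k)).comp (measurable_poissonMeasure_mul_toNNReal lam)
  rw [lintegral_congr_ae h1, lintegral_prod_eq_prod_lintegral_of_indepFun _
    (fun k ω => poissonMeasure (lam * (S k ω).toNNReal) (t k))
    (h.indep_service.comp (fun k x => poissonMeasure (lam * x.toNNReal) (t k)) hmt)
    (fun k => (hmt k).comp (h.measurable_service k))]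
  refine Finset.prod_congr rfl fun k _ => ?_
  rw [mixedPoisson_apply lam B hB, ← h.service_law k,
    lintegral_map (hmt k) (h.measurable_service k)]

end Input

/-! ### Erlang densities -/

/-- The density of the sum of `m + 1` independent exponential variables with rate `lam`. -/
def erlangDensity (lam : ℝ) (m : ℕ) (x : ℝ) : ℝ :=
  lam ^ (m + 1) / (m.factorial : ℝ) * (Real.exp (-(lam * x)) * x ^ m)

theorem continuous_erlangDensity (lam : ℝ) (m : ℕ) : Continuous (erlangDensity lam m) := by
  unfold erlangDensity
  fun_prop

theorem erlangDensity_nonneg {lam : ℝ} (hlam : 0 ≤ lam) (m : ℕ) {x : ℝ} (hx : 0 ≤ x) :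
    0 ≤ erlangDensity lam m x := by
  unfold erlangDensity
  positivity

theorem integrableOn_exp_mul_pow {lam : ℝ} (hlam : 0 < lam) (m : ℕ) :
    IntegrableOn (fun x => Real.exp (-(lam * x)) * x ^ m) (Set.Ioi 0) := by
  have h := integrableOn_rpow_mul_exp_neg_mul_rpow (s := (m : ℝ)) (p := 1) (b := lam)
    (by have := m.cast_nonneg (α := ℝ); linarith) one_pos hlam
  refine h.congr_fun (fun x _ => ?_) measurableSet_Ioi
  simp only [Real.rpow_natCast, Real.rpow_one, neg_mul]
  ring

theorem integrableOn_erlangDensity {lam : ℝ} (hlam : 0 < lam) (m : ℕ) :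
    IntegrableOn (erlangDensity lam m) (Set.Ioi 0) :=
  (integrableOn_exp_mul_pow hlam m).const_mul _

theorem hasDerivAt_poisson_tail (lam : ℝ) (m : ℕ) (x : ℝ) :
    HasDerivAt (fun x => 1 - ∑ k ∈ Finset.range (m + 1),
      Real.exp (-(lam * x)) * (lam * x) ^ k / (k.factorial : ℝ)) (erlangDensity lam m x) x := by
  have he : HasDerivAt (fun x => Real.exp (-(lam * x))) (Real.exp (-(lam * x)) * -lam) x := by
    have := ((hasDerivAt_id x).const_mul lam).neg.exp
    simpa using this
  have hl : HasDerivAt (fun x => lam * x) lam x := by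
    simpa using (hasDerivAt_id x).const_mul lam
  induction m with
  | zero =>
    have := he.const_sub 1
    simp only [zero_add, Finset.range_one, Finset.sum_singleton, pow_zero, mul_one,
      Nat.factorial_zero, Nat.cast_one, div_one, erlangDensity, pow_one]
    refine this.congr_deriv ?_
    ring
  | succ m ih =>
    have h1 := ih.sub ((he.mul (hl.pow (m + 1))).div_const ((m + 1).factorial : ℝ))
    have h2 : (fun x => 1 - ∑ k ∈ Finset.range (m + 1 + 1),
        Real.exp (-(lam * x)) * (lam * x) ^ k / (k.factorial : ℝ)) =
        fun x => (1 - ∑ k ∈ Finset.range (m + 1),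
          Real.exp (-(lam * x)) * (lam * x) ^ k / (k.factorial : ℝ)) -
          Real.exp (-(lam * x)) * (lam * x) ^ (m + 1) / ((m + 1).factorial : ℝ) := by
      funext x
      rw [Finset.sum_range_succ]
      ring
    rw [h2]
    refine h1.congr_deriv ?_
    have hf : ((m + 1).factorial : ℝ) = (m + 1) * m.factorial := by
      rw [Nat.factorial_succ]; push_cast; ring
    have hm : (m : ℝ) + 1 ≠ 0 := by positivity
    have hf0 : (m.factorial : ℝ) ≠ 0 := by positivity
    simp only [erlangDensity, hf, Nat.add_sub_cancel, Pi.pow_apply]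
    push_cast
    field_simp
    ring

/-- There are at least `m + 1` points up to `x` exactly when the Erlang time of the `(m + 1)`-st
point is at most `x`. -/
theorem poissonMeasure_real_Ici (lam : ℝ≥0) (m : ℕ) {x : ℝ} (hx : 0 ≤ x) :
    (poissonMeasure (lam * x.toNNReal)).real (Set.Ici (m + 1)) =
      ∫ u in (0 : ℝ)..x, erlangDensity lam m u := by
  rw [intervalIntegral.integral_eq_sub_of_hasDerivAt
    (fun u _ => hasDerivAt_poisson_tail lam m u)
    ((continuous_erlangDensity lam m).intervalIntegrable _ _)]
  have h0 : ∑ k ∈ Finset.range (m + 1),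
      Real.exp (-((lam : ℝ) * 0)) * ((lam : ℝ) * 0) ^ k / (k.factorial : ℝ) = 1 := by
    rw [Finset.sum_range_succ']
    simp
  have h1 := sum_measureReal_singleton_add (poissonMeasure (lam * x.toNNReal)) 0 (m + 1)
  simp only [zero_add, measureReal_Ici_zero, poissonMeasure_real_singleton, NNReal.coe_mul,
    Real.coe_toNNReal _ hx] at h1
  rw [h0, h1]
  ring

/-- The Erlang density with values in `[0, ∞]`, extended by zero to the negative half-line. -/
def erlangWeight (lam : ℝ) (m : ℕ) : ℝ → ENNReal :=
  (Set.Ioi 0).indicator fun x => ENNReal.ofReal (erlangDensity lam m x)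

theorem measurable_erlangWeight (lam : ℝ) (m : ℕ) : Measurable (erlangWeight lam m) :=
  ((continuous_erlangDensity lam m).measurable.ennreal_ofReal).indicator measurableSet_Ioi

theorem erlangWeight_of_pos (lam : ℝ) (m : ℕ) {x : ℝ} (hx : 0 < x) :
    erlangWeight lam m x = ENNReal.ofReal (erlangDensity lam m x) :=
  Set.indicator_of_mem (show x ∈ Set.Ioi 0 from hx) _

theorem erlangWeight_of_nonpos (lam : ℝ) (m : ℕ) {x : ℝ} (hx : x ≤ 0) :
    erlangWeight lam m x = 0 :=
  Set.indicator_of_notMem (show x ∉ Set.Ioi 0 from not_lt.mpr hx) _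

theorem poissonMeasure_Ici (lam : ℝ≥0) (m : ℕ) {x : ℝ} (hx : 0 ≤ x) :
    poissonMeasure (lam * x.toNNReal) (Set.Ici (m + 1)) =
      ∫⁻ u, erlangWeight lam m u * (Set.Iio x).indicator 1 u := by
  have h1 : ∀ u, erlangWeight lam m u * (Set.Iio x).indicator 1 u =
      (Set.Ioo 0 x).indicator (fun u => ENNReal.ofReal (erlangDensity lam m u)) u := fun u => by
    rw [erlangWeight, ← Set.Ioi_inter_Iio, ← Set.indicator_indicator]
    simp only [Set.indicator_apply, Pi.one_apply]
    split_ifs <;> simp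
  simp_rw [h1]
  rw [← ofReal_measureReal, poissonMeasure_real_Ici lam m hx,
    intervalIntegral.integral_of_le hx, integral_Ioc_eq_integral_Ioo,
    lintegral_indicator measurableSet_Ioo, ofReal_integral_eq_lintegral_ofReal]
  · exact (continuous_erlangDensity lam m).integrableOn_Icc.mono_set Set.Ioo_subset_Icc_self
  · exact (ae_restrict_mem measurableSet_Ioo).mono fun u hu =>
      erlangDensity_nonneg lam.coe_nonneg m hu.1.le

theorem measurable_measure_Ioi (G : Measure ℝ) : Measurable fun x => G (Set.Ioi x) :=
  (antitone_iff_forall_lt.mpr fun _ _ h => measure_mono (Set.Ioi_subset_Ioi h.le)).measurable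

/-- Tonelli: the service must outlast the Erlang time `u` of the `(m + 1)`-st arrival. -/
theorem mixedPoisson_Ici (lam : ℝ≥0) (G : Measure ℝ) [IsProbabilityMeasure G]
    (hG : G (Set.Iio 0) = 0) (m : ℕ) :
    mixedPoisson lam G (Set.Ici (m + 1)) = ∫⁻ u, erlangWeight lam m u * G (Set.Ioi u) := by
  have hpos : ∀ᵐ x ∂G, 0 ≤ x := by
    rw [ae_iff]; convert hG using 2; ext x; simp
  rw [mixedPoisson_apply lam G hG,
    lintegral_congr_ae (hpos.mono fun x hx => poissonMeasure_Ici lam m hx)]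
  have hmeas : Measurable (Function.uncurry fun x u : ℝ =>
      erlangWeight lam m u * (Set.Iio x).indicator (1 : ℝ → ENNReal) u) := by
    have h1 : MeasurableSet {z : ℝ × ℝ | z.2 < z.1} := measurableSet_lt measurable_snd measurable_fst
    have h2 : (Function.uncurry fun x u : ℝ =>
        erlangWeight lam m u * (Set.Iio x).indicator (1 : ℝ → ENNReal) u) =
        fun z => erlangWeight lam m z.2 *
          {z : ℝ × ℝ | z.2 < z.1}.indicator (1 : ℝ × ℝ → ENNReal) z := by
      funext z
      simp [Function.uncurry, Set.indicator_apply]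
    rw [h2]
    exact ((measurable_erlangWeight lam m).comp measurable_snd).mul
      (measurable_one.indicator h1)
  rw [lintegral_lintegral_swap hmeas.aemeasurable]
  refine lintegral_congr fun u => ?_
  have h3 : ∀ x, (Set.Iio x).indicator (1 : ℝ → ENNReal) u = (Set.Ioi u).indicator 1 x := fun x => by
    simp [Set.indicator_apply]
  simp_rw [h3]
  rw [lintegral_const_mul _ (measurable_one.indicator measurableSet_Ioi),
    lintegral_indicator_one measurableSet_Ioi]

theorem lintegral_erlangWeight_mul_sub (lam : ℝ) (hlam : 0 ≤ lam) (m : ℕ) (v : ℝ) :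
    ∫⁻ x, erlangWeight lam m x * erlangWeight lam 0 (v - x) = erlangWeight lam (m + 1) v := by
  rcases le_or_gt v 0 with hv | hv
  · rw [erlangWeight_of_nonpos _ _ hv, ← lintegral_zero (μ := (volume : Measure ℝ))]
    refine lintegral_congr fun x => ?_
    rcases le_or_gt x 0 with hx | hx
    · rw [erlangWeight_of_nonpos _ _ hx, zero_mul]
    · rw [erlangWeight_of_nonpos lam 0 (by linarith : v - x ≤ 0), mul_zero]
  · have h1 : ∀ x, erlangWeight lam m x * erlangWeight lam 0 (v - x) =
        (Set.Ioo 0 v).indicator (fun x => ENNReal.ofReal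
          (lam ^ (m + 2) / (m.factorial : ℝ) * Real.exp (-(lam * v)) * x ^ m)) x := fun x => by
      rcases le_or_gt x 0 with hx | hx
      · rw [erlangWeight_of_nonpos _ _ hx, zero_mul, Set.indicator_of_notMem]
        exact fun h => not_lt.mpr hx h.1
      · rcases le_or_gt v x with hvx | hvx
        · rw [erlangWeight_of_nonpos lam 0 (by linarith : v - x ≤ 0), mul_zero,
            Set.indicator_of_notMem]
          exact fun h => not_lt.mpr hvx h.2
        · rw [erlangWeight_of_pos _ _ hx, erlangWeight_of_pos _ _ (sub_pos.mpr hvx),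
            Set.indicator_of_mem (show x ∈ Set.Ioo 0 v from ⟨hx, hvx⟩),
            ← ENNReal.ofReal_mul (erlangDensity_nonneg hlam m hx.le)]
          congr 1
          have : Real.exp (-(lam * v)) =
              Real.exp (-(lam * x)) * Real.exp (-(lam * (v - x))) := by
            rw [← Real.exp_add]; congr 1; ring
          rw [this]
          simp only [erlangDensity, Nat.factorial_zero, Nat.cast_one]
          ring
    simp_rw [h1]
    rw [lintegral_indicator measurableSet_Ioo, erlangWeight_of_pos _ _ hv,
      ← ofReal_integral_eq_lintegral_ofReal]
    · congr 1
      rw [integral_const_mul, ← integral_Ioc_eq_integral_Ioo, ← intervalIntegral.integral_of_le hv.le,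
        integral_pow, erlangDensity, Nat.factorial_succ]
      have hm : (m : ℝ) + 1 ≠ 0 := by positivity
      have hf0 : (m.factorial : ℝ) ≠ 0 := by positivity
      push_cast
      field_simp
      ring
    · exact ((by fun_prop : Continuous fun x : ℝ =>
        lam ^ (m + 2) / (m.factorial : ℝ) * Real.exp (-(lam * v)) * x ^ m).integrableOn_Icc
          (a := 0) (b := v)).mono_set Set.Ioo_subset_Icc_self
    · refine (ae_restrict_mem measurableSet_Ioo).mono fun x hx => ?_
      have := hx.1.le
      simp only [Pi.zero_apply]
      positivity

theorem lintegral_erlangWeight_succ {lam : ℝ} (hlam : 0 ≤ lam) (m : ℕ) {f : ℝ → ENNReal}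
    (hf : Measurable f) :
    ∫⁻ v, erlangWeight lam (m + 1) v * f v =
      ∫⁻ x, erlangWeight lam m x * ∫⁻ u, erlangWeight lam 0 u * f (x + u) := by
  have h1 : ∀ x, ∫⁻ u, erlangWeight lam 0 u * f (x + u) =
      ∫⁻ v, erlangWeight lam 0 (v - x) * f v := fun x => by
    rw [← lintegral_add_left_eq_self (fun v => erlangWeight lam 0 (v - x) * f v) x]
    simp
  have hm : ∀ m, Measurable (erlangWeight lam m) := measurable_erlangWeight lam
  simp_rw [h1]
  have h2 : ∀ x, erlangWeight lam m x * ∫⁻ v, erlangWeight lam 0 (v - x) * f v =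
      ∫⁻ v, erlangWeight lam m x * (erlangWeight lam 0 (v - x) * f v) := fun x =>
    (lintegral_const_mul _ (((hm 0).comp (by fun_prop)).mul hf)).symm
  simp_rw [h2]
  rw [lintegral_lintegral_swap]
  · refine lintegral_congr fun v => ?_
    simp_rw [← mul_assoc]
    have hmv : Measurable fun x => erlangWeight lam m x * erlangWeight lam 0 (v - x) :=
      (hm m).mul ((hm 0).comp (measurable_const.sub measurable_id))
    rw [lintegral_mul_const _ hmv,
      lintegral_erlangWeight_mul_sub lam hlam]
  · exact (((hm m).comp measurable_fst).mul
      (((hm 0).comp (measurable_snd.sub measurable_fst)).mul (hf.comp measurable_snd))).aemeasurable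

/-- The sum of independent Erlang variables with the same rate is an Erlang variable. -/
theorem lintegral_erlangWeight_add {lam : ℝ} (hlam : 0 ≤ lam) (r m : ℕ) {f : ℝ → ENNReal}
    (hf : Measurable f) :
    ∫⁻ v, erlangWeight lam (r + m + 1) v * f v =
      ∫⁻ y, erlangWeight lam r y * ∫⁻ x, erlangWeight lam m x * f (y + x) := by
  induction m generalizing f with
  | zero => exact lintegral_erlangWeight_succ hlam r hf
  | succ m ih =>
    have hg : Measurable fun z => ∫⁻ u, erlangWeight lam 0 u * f (z + u) := by
      refine Measurable.lintegral_prod_right' (f := fun z : ℝ × ℝ =>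
        erlangWeight lam 0 z.2 * f (z.1 + z.2)) ?_
      exact ((measurable_erlangWeight lam 0).comp measurable_snd).mul
        (hf.comp (measurable_fst.add measurable_snd))
    rw [← add_assoc, lintegral_erlangWeight_succ hlam _ hf, ih hg]
    refine lintegral_congr fun y => ?_
    rw [lintegral_erlangWeight_succ hlam m (f := fun x => f (y + x)) (hf.comp (by fun_prop))]
    simp_rw [add_assoc]

/-! ### Tails of mixed Poisson laws -/

theorem measureReal_Ioi_eq (G : Measure ℝ) [IsProbabilityMeasure G] (x : ℝ) :
    G.real (Set.Ioi x) = 1 - cdf G x := by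
  rw [cdf_eq_real, ← Set.compl_Iic, measureReal_compl measurableSet_Iic, probReal_univ]

theorem measurable_erlangWeight_mul_Ioi (lam : ℝ) (m : ℕ) (G : Measure ℝ) :
    Measurable fun x => erlangWeight lam m x * G (Set.Ioi x) :=
  (measurable_erlangWeight lam m).mul (measurable_measure_Ioi G)

theorem integrableOn_erlangDensity_mul_cdf {lam : ℝ} (hlam : 0 < lam) (m : ℕ) (G : Measure ℝ) :
    IntegrableOn (fun x => erlangDensity lam m x * cdf G x) (Set.Ioi 0) := by
  refine (integrableOn_erlangDensity hlam m).mul_bdd (c := 1)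
    (monotone_cdf G).measurable.aestronglyMeasurable (ae_of_all _ fun x => ?_)
  rw [Real.norm_of_nonneg (cdf_nonneg G x)]
  exact cdf_le_one G x

theorem lintegral_erlangWeight_mul_Ioi {lam : ℝ} (hlam : 0 < lam) (m : ℕ) (G : Measure ℝ)
    [IsProbabilityMeasure G] :
    ∫⁻ x, erlangWeight lam m x * G (Set.Ioi x) =
      ENNReal.ofReal ((∫ x in Set.Ioi (0 : ℝ), erlangDensity lam m x) -
        ∫ x in Set.Ioi (0 : ℝ), erlangDensity lam m x * cdf G x) := by
  have h1 : ∀ x, erlangWeight lam m x * G (Set.Ioi x) = (Set.Ioi 0).indicator (fun x =>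
      ENNReal.ofReal (erlangDensity lam m x - erlangDensity lam m x * cdf G x)) x := fun x => by
    rcases le_or_gt x 0 with hx | hx
    · rw [erlangWeight_of_nonpos _ _ hx, zero_mul,
        Set.indicator_of_notMem (show x ∉ Set.Ioi 0 from not_lt.mpr hx)]
    · rw [erlangWeight_of_pos _ _ hx, Set.indicator_of_mem (show x ∈ Set.Ioi 0 from hx),
        ← ofReal_measureReal, measureReal_Ioi_eq,
        ← ENNReal.ofReal_mul (erlangDensity_nonneg hlam.le m hx.le), mul_sub, mul_one]
  simp_rw [h1]
  rw [lintegral_indicator measurableSet_Ioi, ← integral_sub (integrableOn_erlangDensity hlam m)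
    (integrableOn_erlangDensity_mul_cdf hlam m G), ofReal_integral_eq_lintegral_ofReal]
  · exact (integrableOn_erlangDensity hlam m).sub (integrableOn_erlangDensity_mul_cdf hlam m G)
  · refine (ae_restrict_mem measurableSet_Ioi).mono fun x (hx : 0 < x) => ?_
    have := erlangDensity_nonneg hlam.le m hx.le
    have := cdf_le_one G x
    simp only [Pi.zero_apply]
    nlinarith

/-- Up to a positive constant the weight in `CLe` is an Erlang density. The order therefore compares
tails averaged over Erlang times, that is, the tails of mixed Poisson laws. -/
theorem CLe.lintegral_le {lam : ℝ} (hlam : 0 < lam) {G H : Measure ℝ} [IsProbabilityMeasure G]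
    [IsProbabilityMeasure H] (h : CLe lam G H) (m : ℕ) :
    ∫⁻ x, erlangWeight lam m x * G (Set.Ioi x) ≤ ∫⁻ x, erlangWeight lam m x * H (Set.Ioi x) := by
  rw [lintegral_erlangWeight_mul_Ioi hlam, lintegral_erlangWeight_mul_Ioi hlam]
  refine ENNReal.ofReal_le_ofReal (sub_le_sub_left ?_ _)
  have h1 : ∀ K : Measure ℝ, ∫ x in Set.Ioi (0 : ℝ), erlangDensity lam m x * cdf K x =
      lam ^ (m + 1) / (m.factorial : ℝ) *
        ∫ x in Set.Ioi (0 : ℝ), Real.exp (-(lam * x)) * x ^ m * cdf K x := fun K => by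
    rw [← integral_const_mul]
    simp only [erlangDensity, mul_assoc]
  rw [h1, h1]
  exact mul_le_mul_of_nonneg_left (h m) (by positivity)

/-! ### Residual laws and the discrete tail inequalities -/

theorem residual_Iio_zero (B : Measure ℝ) (y : ℝ) : residual B y (Set.Iio 0) = 0 := by
  unfold residual
  split_ifs with h
  · simp
  · rw [Measure.map_apply (by fun_prop) measurableSet_Iio, cond_apply measurableSet_Ioi]
    have : Set.Ioi y ∩ (fun x => x - y) ⁻¹' Set.Iio 0 = ∅ := by
      rw [Set.eq_empty_iff_forall_notMem]
      rintro x ⟨h1, h2⟩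
      rw [Set.mem_Ioi] at h1
      rw [Set.mem_preimage, Set.mem_Iio] at h2
      linarith
    rw [this, measure_empty, mul_zero]

/-- If no mass lies beyond `y` both sides vanish, whatever the convention for `residual`. -/
theorem measure_Ioi_add (B : Measure ℝ) [IsProbabilityMeasure B] (y : ℝ) {x : ℝ} (hx : 0 ≤ x) :
    B (Set.Ioi (y + x)) = B (Set.Ioi y) * residual B y (Set.Ioi x) := by
  have hsub : Set.Ioi (y + x) ⊆ Set.Ioi y := Set.Ioi_subset_Ioi (by linarith)
  unfold residual
  split_ifs with h
  · rw [h, zero_mul]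
    exact measure_mono_null hsub h
  · rw [Measure.map_apply (by fun_prop) measurableSet_Ioi, cond_apply measurableSet_Ioi]
    have : (fun z => z - y) ⁻¹' Set.Ioi x = Set.Ioi (y + x) := by
      ext z; simp [add_comm]
    rw [this, Set.inter_eq_right.mpr hsub, ← mul_assoc,
      ENNReal.mul_inv_cancel h (measure_ne_top _ _), one_mul]

theorem IsNBU.measure_Ioi_add_le {B : Measure ℝ} [IsProbabilityMeasure B] (h : IsNBU B) {x y : ℝ}
    (hx : 0 ≤ x) (hy : 0 ≤ y) : B (Set.Ioi (x + y)) ≤ B (Set.Ioi x) * B (Set.Ioi y) := by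
  have := h x y hx hy
  simp only [← measureReal_Ioi_eq] at this
  rw [← ofReal_measureReal, ← ofReal_measureReal, ← ofReal_measureReal,
    ← ENNReal.ofReal_mul measureReal_nonneg]
  exact ENNReal.ofReal_le_ofReal this

section Tails

variable {lam : ℝ≥0} {B : Measure ℝ} [IsProbabilityMeasure B]

/-- The first `r + 1` arrivals take an Erlang time `y`, the next `m + 1` an independent Erlang time
`x`. -/
theorem mixedPoisson_Ici_add (hB : B (Set.Iio 0) = 0) (r m : ℕ) :
    mixedPoisson lam B (Set.Ici (r + 1 + (m + 1))) =
      ∫⁻ y, erlangWeight lam r y * ∫⁻ x, erlangWeight lam m x * B (Set.Ioi (y + x)) := by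
  have : r + 1 + (m + 1) = r + m + 1 + 1 := by ring
  rw [this, mixedPoisson_Ici lam B hB,
    lintegral_erlangWeight_add lam.coe_nonneg r m (measurable_measure_Ioi B)]

theorem IsNBU.mixedPoisson_Ici_add_le (h : IsNBU B) (hB : B (Set.Iio 0) = 0) (r m : ℕ) :
    mixedPoisson lam B (Set.Ici (r + m)) ≤
      mixedPoisson lam B (Set.Ici r) * mixedPoisson lam B (Set.Ici m) := by
  have := isProbabilityMeasure_mixedPoisson lam B hB
  have h0 : mixedPoisson lam B (Set.Ici 0) = 1 := by
    rw [show Set.Ici (0 : ℕ) = Set.univ by ext; simp, measure_univ]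
  cases r with
  | zero => rw [h0, one_mul, zero_add]
  | succ r =>
  cases m with
  | zero => rw [h0, mul_one, add_zero]
  | succ m =>
    rw [mixedPoisson_Ici_add hB, mixedPoisson_Ici lam B hB, mixedPoisson_Ici lam B hB,
      ← lintegral_mul_const _ (measurable_erlangWeight_mul_Ioi _ _ B)]
    refine lintegral_mono fun y => ?_
    rcases le_or_gt y 0 with hy | hy
    · simp [erlangWeight_of_nonpos _ _ hy]
    rw [mul_assoc]
    refine mul_le_mul_right ?_ _
    rw [← lintegral_const_mul _ (measurable_erlangWeight_mul_Ioi _ _ B)]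
    refine lintegral_mono fun x => ?_
    rcases le_or_gt x 0 with hx | hx
    · simp [erlangWeight_of_nonpos _ _ hx]
    rw [mul_left_comm]
    exact mul_le_mul_right (h.measure_Ioi_add_le hy.le hx.le) _

/-- At whatever age `y` the `r`-th arrival finds the service, the arrivals in the residual service
dominate those in a service with law `B_{y₀}`. -/
theorem mixedPoisson_Ici_mul_le (hlam : 0 < lam) (hB : B (Set.Iic 0) = 0) {y₀ : ℝ}
    (hmin : ∀ y : ℝ, 0 ≤ y → CLe lam (residual B y₀) (residual B y)) (r m : ℕ) :
    mixedPoisson lam B (Set.Ici r) * mixedPoisson lam (residual B y₀) (Set.Ici m) ≤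
      mixedPoisson lam B (Set.Ici (r + m)) := by
  have hB' : B (Set.Iio 0) = 0 := measure_mono_null Set.Iio_subset_Iic_self hB
  have := isProbabilityMeasure_mixedPoisson lam B hB'
  have := isProbabilityMeasure_mixedPoisson lam (residual B y₀) (residual_Iio_zero B y₀)
  have h0 : mixedPoisson lam B (Set.Ici 0) = 1 := by
    rw [show Set.Ici (0 : ℕ) = Set.univ by ext; simp, measure_univ]
  have h0' : mixedPoisson lam (residual B y₀) (Set.Ici 0) = 1 := by
    rw [show Set.Ici (0 : ℕ) = Set.univ by ext; simp, measure_univ]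
  cases m with
  | zero => rw [h0', mul_one, add_zero]
  | succ m =>
  have key : ∀ y, 0 ≤ y → B (Set.Ioi y) * mixedPoisson lam (residual B y₀) (Set.Ici (m + 1)) ≤
      ∫⁻ x, erlangWeight lam m x * B (Set.Ioi (y + x)) := by
    intro y hy
    rw [mixedPoisson_Ici lam _ (residual_Iio_zero B y₀)]
    refine (mul_le_mul_right ((hmin y hy).lintegral_le (by exact_mod_cast hlam) m) _).trans
      (le_of_eq ?_)
    rw [← lintegral_const_mul _ (measurable_erlangWeight_mul_Ioi _ _ _)]
    refine lintegral_congr fun x => ?_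
    rcases le_or_gt x 0 with hx | hx
    · simp [erlangWeight_of_nonpos _ _ hx]
    rw [measure_Ioi_add B y hx.le, mul_left_comm]
  cases r with
  | zero =>
    -- For `r = 0` there is no Erlang time to average over; `key` is used at age `0`, where `B(0) =
    -- 0` gives full mass.
    have h1 : B (Set.Ioi 0) = 1 := by
      rw [← Set.compl_Iic, prob_compl_eq_one_sub measurableSet_Iic, hB, tsub_zero]
    have h2 := key 0 le_rfl
    simp only [zero_add] at h2
    rw [h1, ← mixedPoisson_Ici lam B hB'] at h2
    rwa [h0, Nat.zero_add]
  | succ r =>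
    rw [mixedPoisson_Ici_add hB', mixedPoisson_Ici lam B hB',
      ← lintegral_mul_const _ (measurable_erlangWeight_mul_Ioi _ _ B)]
    refine lintegral_mono fun y => ?_
    rcases le_or_gt y 0 with hy | hy
    · simp [erlangWeight_of_nonpos _ _ hy]
    rw [mul_assoc]
    exact mul_le_mul_right (key y hy.le) _

end Tails

/-! ### Laplace transforms -/

theorem mixedPoisson_real_zero {lam : ℝ≥0} {G : Measure ℝ} [IsProbabilityMeasure G]
    (hG : G (Set.Iio 0) = 0) : (mixedPoisson lam G).real {0} = laplace G lam := by
  have hr : G.restrict (Set.Ici 0) = G :=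
    Measure.restrict_eq_self_of_ae_mem (by
      rw [ae_iff]; convert hG using 2; ext x; simp)
  rw [Measure.real, mixedPoisson, Measure.sum_smul_dirac_singleton, hr,
    ENNReal.toReal_ofReal (integral_nonneg fun x => by simp [Real.exp_nonneg]), laplace]
  simp

theorem laplace_pos {lam : ℝ≥0} {G : Measure ℝ} [IsProbabilityMeasure G]
    (hG : G (Set.Iio 0) = 0) : 0 < laplace G lam := by
  have hpos : ∀ᵐ x ∂G, 0 ≤ x := by
    rw [ae_iff]; convert hG using 2; ext x; simp
  refine integral_exp_pos (Integrable.of_bound (by fun_prop) 1 (hpos.mono fun x hx => ?_))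
  rw [Real.norm_of_nonneg (Real.exp_nonneg _), Real.exp_le_one_iff]
  have : 0 ≤ (lam : ℝ) * x := mul_nonneg lam.coe_nonneg hx
  linarith

/-- The Laplace transform of a residual law is close to that of the law itself. -/
theorem NearMemoryless.abs_laplace_residual_sub_lt {lam : ℝ≥0} (hlam : 0 < lam) {B : Measure ℝ}
    [IsProbabilityMeasure B] (hB : B (Set.Iio 0) = 0) {ε : ℝ} (h : NearMemoryless B ε) {y : ℝ}
    (hy : 0 ≤ y) : |laplace (residual B y) lam - laplace B lam| < ε := by
  have hl : (0 : ℝ) < lam := by exact_mod_cast hlam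
  refine lt_of_le_of_lt ?_ h
  set M := ⨆ p : ℝ≥0 × ℝ≥0, |cdf (residual B p.2) p.1 - cdf B p.1| with hM
  have hle : ∀ x, 0 ≤ x → |cdf (residual B y) x - cdf B x| ≤ M := by
    intro x hx
    refine le_ciSup (f := fun p : ℝ≥0 × ℝ≥0 => |cdf (residual B p.2) p.1 - cdf B p.1|) ⟨1, ?_⟩
      (⟨x, hx⟩, ⟨y, hy⟩)
    rintro _ ⟨p, rfl⟩
    have h1 := cdf_nonneg (residual B p.2) p.1
    have h2 := cdf_le_one (residual B p.2) p.1
    have h3 := cdf_nonneg B p.1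
    have h4 := cdf_le_one B p.1
    exact abs_le.mpr ⟨by linarith, by linarith⟩
  have hint1 : ∫ x in Set.Ioi (0 : ℝ), erlangDensity lam 0 x = 1 := by
    have := integral_exp_mul_Ioi (a := -(lam : ℝ)) (by linarith) 0
    simp only [erlangDensity, zero_add, pow_one, Nat.factorial_zero, Nat.cast_one, div_one,
      pow_zero, mul_one]
    simp only [neg_mul, mul_zero, Real.exp_zero] at this
    rw [integral_const_mul, this]
    field_simp
  -- The transform is the probability of no arrival, so the Erlang tail formula with `m = 0`
  -- replaces an integration by parts. Averaging against a probability density then cannot exceed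
  -- the supremum `M`.
  have hlap : ∀ (G : Measure ℝ) [IsProbabilityMeasure G], G (Set.Iio 0) = 0 →
      laplace G lam = ∫ x in Set.Ioi (0 : ℝ), erlangDensity lam 0 x * cdf G x := by
    intro G _ hG
    have := isProbabilityMeasure_mixedPoisson lam G hG
    have h1 := measureReal_singleton_eq_sub (mixedPoisson lam G) 0
    have h2 := mixedPoisson_Ici lam G hG 0
    rw [lintegral_erlangWeight_mul_Ioi hl, hint1] at h2
    rw [mixedPoisson_real_zero hG, measureReal_Ici_zero, Measure.real, h2,
      ENNReal.toReal_ofReal] at h1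
    · rw [h1]; ring
    · rw [sub_nonneg, ← hint1]
      refine setIntegral_mono_on (integrableOn_erlangDensity_mul_cdf hl 0 G)
        (integrableOn_erlangDensity hl 0) measurableSet_Ioi fun x hx => ?_
      exact mul_le_of_le_one_right (erlangDensity_nonneg hl.le 0 (le_of_lt hx)) (cdf_le_one G x)
  rw [hlap _ (residual_Iio_zero B y), hlap B hB,
    ← integral_sub (integrableOn_erlangDensity_mul_cdf hl 0 _)
      (integrableOn_erlangDensity_mul_cdf hl 0 _)]
  have hb : ∀ᵐ x ∂(volume.restrict (Set.Ioi (0 : ℝ))),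
      ‖erlangDensity lam 0 x * cdf (residual B y) x - erlangDensity lam 0 x * cdf B x‖ ≤
        erlangDensity lam 0 x * M := by
    refine (ae_restrict_mem measurableSet_Ioi).mono fun x (hx : 0 < x) => ?_
    have := erlangDensity_nonneg hl.le 0 hx.le
    rw [← mul_sub, Real.norm_eq_abs, abs_mul, abs_of_nonneg this]
    exact mul_le_mul_of_nonneg_left (hle x hx.le) this
  refine (norm_integral_le_of_norm_le ((integrableOn_erlangDensity hl 0).mul_const M) hb).trans ?_
  rw [integral_mul_const, hint1, one_mul]

/-! ### Generating functions -/

theorem one_sub_add_mul_pos {b : ℝ} (hb : 0 < b) {x : ℝ} (hx : 0 ≤ x) (hx' : x ≤ 1) :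
    0 < 1 - x + x * b := by
  rcases hx.eq_or_lt with rfl | h
  · norm_num
  · nlinarith [mul_pos h hb]

theorem le_norm_one_sub_add_mul {𝕜 : Type*} [RCLike 𝕜] {b : ℝ} (hb' : b ≤ 1) (z : 𝕜) :
    1 - ‖z‖ + ‖z‖ * b ≤ ‖1 - z + z * (b : 𝕜)‖ := by
  have h1 : (1 : 𝕜) - z + z * (b : 𝕜) = 1 - ((1 - b : ℝ) : 𝕜) * z := by
    push_cast; ring
  have h2 := norm_sub_norm_le (1 : 𝕜) (((1 - b : ℝ) : 𝕜) * z)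
  rw [norm_mul, RCLike.norm_ofReal, abs_of_nonneg (by linarith), norm_one] at h2
  rw [h1]
  linarith

theorem one_sub_add_mul_ne_zero {𝕜 : Type*} [RCLike 𝕜] {b : ℝ} (hb : 0 < b)
    (hb' : b ≤ 1) {z : 𝕜} (hz : ‖z‖ ≤ 1) : 1 - z + z * (b : 𝕜) ≠ 0 :=
  norm_pos_iff.mp <| (one_sub_add_mul_pos hb (norm_nonneg z) hz).trans_le
    (le_norm_one_sub_add_mul hb' z)

section Pgf

variable {𝕜 : Type*} [RCLike 𝕜] {a b : ℝ} (ha : 0 ≤ a) (ha' : a ≤ 1) (hb : 0 < b) (hb' : b ≤ 1)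

theorem pgf_delayedGeometric {z : 𝕜} (hz : ‖z‖ ≤ 1) :
    pgf (delayedGeometric a b ha ha' hb hb') z =
      (b : 𝕜) / (1 - z + z * (b : 𝕜)) + ((a - b : ℝ) : 𝕜) * ((1 - z) / (1 - z + z * (b : 𝕜))) := by
  have hne := one_sub_add_mul_ne_zero hb hb' hz
  have hlt : ‖((1 - b : ℝ) : 𝕜) * z‖ < 1 := by
    rw [norm_mul, RCLike.norm_ofReal, abs_of_nonneg (by linarith)]
    nlinarith [norm_nonneg z]
  have hg := (hasSum_geometric_of_norm_lt_one hlt).mul_left (((1 - a) * b : ℝ) * z : 𝕜)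
  have hs : HasSum (fun m => ((delayedGeometricWeight a b m : ℝ) : 𝕜) * z ^ m)
      (((1 - a) * b : ℝ) * z * (1 - ((1 - b : ℝ) : 𝕜) * z)⁻¹ + a) := by
    rw [← hasSum_nat_add_iff' 1]
    simp only [Finset.range_one, Finset.sum_singleton, pow_zero, mul_one, delayedGeometricWeight,
      add_sub_cancel_right]
    refine hg.congr_fun fun k => ?_
    rw [mul_pow]
    push_cast
    ring
  have h1 : (1 : 𝕜) - ((1 - b : ℝ) : 𝕜) * z = 1 - z + z * (b : 𝕜) := by
    push_cast; ring
  unfold pgf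
  simp_rw [delayedGeometric_apply]
  rw [hs.tsum_eq, h1]
  field_simp
  push_cast
  ring

theorem pgf_delayedGeometric_self {z : 𝕜} (hz : ‖z‖ ≤ 1) :
    pgf (delayedGeometric b b hb.le hb' hb hb') z = (b : 𝕜) / (1 - z + z * (b : 𝕜)) := by
  rw [pgf_delayedGeometric hb.le hb' hb hb' hz]
  simp

theorem norm_pgf_delayedGeometric_sub_lt {ε : ℝ} (hε : |a - b| < ε) {z : 𝕜} (hz : ‖z‖ ≤ 1) :
    ‖pgf (delayedGeometric a b ha ha' hb hb') z - (b : 𝕜) / (1 - z + z * (b : 𝕜))‖ <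
      ε * ((1 - ‖z‖ + 2 * ‖z‖ * b) / (1 - ‖z‖ + ‖z‖ * b)) := by
  have hD := one_sub_add_mul_pos hb (norm_nonneg z) hz
  have hR : (1 - ‖z‖ + 2 * ‖z‖ * b) / (1 - ‖z‖ + ‖z‖ * b) =
      1 + ‖z‖ * b / (1 - ‖z‖ + ‖z‖ * b) := by
    field_simp
    ring
  have hR0 : 0 < (1 - ‖z‖ + 2 * ‖z‖ * b) / (1 - ‖z‖ + ‖z‖ * b) := by
    rw [hR]; positivity
  have hne := one_sub_add_mul_ne_zero hb hb' hz
  -- The triangle inequality applied to this form produces the bound `1 + |z| b / (1 - |z| + |z|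
  -- b)`, hence the term `2 |z| b`.
  have h1 : (1 - z) / (1 - z + z * (b : 𝕜)) = 1 - z * b / (1 - z + z * (b : 𝕜)) := by
    field_simp
    ring
  rw [pgf_delayedGeometric ha ha' hb hb' hz, add_sub_cancel_left, norm_mul, RCLike.norm_ofReal]
  refine (mul_le_mul_of_nonneg_left ?_ (abs_nonneg _)).trans_lt
    (mul_lt_mul_of_pos_right hε hR0)
  rw [hR, h1]
  refine (norm_sub_le _ _).trans ?_
  rw [norm_one, norm_div, norm_mul, RCLike.norm_ofReal, abs_of_pos hb]
  gcongr
  exact le_norm_one_sub_add_mul hb' z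

end Pgf

end LossQueue

end

/-! ### The theorem -/

open LossQueue in

theorem theorem4p2
    (lam : ℝ≥0) (hlam : 0 < lam)
    (B : Measure ℝ) [IsProbabilityMeasure B] (hB0 : cdf B 0 = 0)
    (ε : ℝ) (hNBU : LossQueue.IsNBU B) (hε : LossQueue.NearMemoryless B ε)
    (y₀ : ℝ) (hy₀ : 0 ≤ y₀)
    (hmin : ∀ y : ℝ, 0 ≤ y →
      LossQueue.CLe lam (LossQueue.residual B y₀) (LossQueue.residual B y))
    {Ω : Type*} [MeasurableSpace Ω] (P : Measure Ω) [IsProbabilityMeasure P]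
    (N : ℝ≥0 → Ω → ℕ) (S : ℕ → Ω → ℝ) (hNS : LossQueue.IsQueueInput lam B N S P)
    (b : ℝ) (hb : b = LossQueue.laplace B lam) :
    ∃ pX pY : PMF ℕ,
      -- the offspring generating function of the lower process on `[0, 1]`
      (∀ z : ℝ, 0 ≤ z → z ≤ 1 →
        LossQueue.pgf pX z
          < b / (1 - z + z * b) + ε * ((1 - z + 2 * z * b) / (1 - z + z * b))) ∧
      -- the corresponding estimate on the closed complex unit disc
      (∀ z : ℂ, ‖z‖ ≤ 1 →
        ‖LossQueue.pgf pX z - (b : ℂ) / (1 - z + z * (b : ℂ))‖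
          < ε * ((1 - ‖z‖ + 2 * ‖z‖ * b) / (1 - ‖z‖ + ‖z‖ * b))) ∧
      -- the offspring generating function of the upper process
      (∀ z : ℂ, ‖z‖ ≤ 1 →
        LossQueue.pgf pY z = (b : ℂ) / (1 - z + z * (b : ℂ))) ∧
      ∀ n : ℕ,
        LossQueue.StLe
          (LossQueue.randomSum (LossQueue.galtonWatson pX n)
            (LossQueue.mixedPoisson lam (LossQueue.residual B y₀)))
          (P.map (LossQueue.busyPeriodLosses n N S)) ∧
        LossQueue.StLe
          (P.map (LossQueue.busyPeriodLosses n N S))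
          (LossQueue.randomSum (LossQueue.galtonWatson pY n)
            (LossQueue.mixedPoisson lam B)) := by
  have hB : B (Set.Iic 0) = 0 := by rw [← ofReal_cdf, hB0, ENNReal.ofReal_zero]
  have hB' : B (Set.Iio 0) = 0 := measure_mono_null Set.Iio_subset_Iic_self hB
  have hπ := isProbabilityMeasure_mixedPoisson lam B hB'
  have hc := isProbabilityMeasure_mixedPoisson lam _ (residual_Iio_zero B y₀)
  have hb0 : (mixedPoisson lam B).real {0} = b := by rw [hb, mixedPoisson_real_zero hB']
  have hb1 : 0 < b := hb ▸ laplace_pos hB'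
  have hb2 : b ≤ 1 := hb0 ▸ measureReal_le_one
  set a := (mixedPoisson lam (residual B y₀)).real {0} with ha
  have ha1 : 0 ≤ a := measureReal_nonneg
  have ha2 : a ≤ 1 := measureReal_le_one
  have hab : |a - b| < ε := by
    rw [ha, mixedPoisson_real_zero (residual_Iio_zero B y₀), hb]
    exact hε.abs_laplace_residual_sub_lt hlam hB' hy₀
  refine ⟨delayedGeometric a b ha1 ha2 hb1 hb2, delayedGeometric b b hb1.le hb2 hb1 hb2,
    fun z hz hz' => ?_, fun z hz => norm_pgf_delayedGeometric_sub_lt ha1 ha2 hb1 hb2 hab hz,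
    fun z hz => pgf_delayedGeometric_self hb1 hb2 hz, fun n => ?_⟩
  · have hn : ‖z‖ = z := by rw [Real.norm_eq_abs, abs_of_nonneg hz]
    have h := norm_pgf_delayedGeometric_sub_lt ha1 ha2 hb1 hb2 hab (z := z) (by rwa [hn])
    rw [hn, Real.norm_eq_abs] at h
    have := (le_abs_self _).trans_lt h
    exact sub_lt_iff_lt_add'.mp this
  · have hmap : P.map (busyPeriodLosses n N S) =
        (Measure.infinitePi fun _ : ℕ => mixedPoisson lam B).map (losses n) := by
      rw [← hNS.map_arrivals hB', Measure.map_map (measurable_losses n) hNS.measurable_arrivals]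
      rfl
    rw [hmap]
    refine stLe_map_losses _ _ ha1 ha2 hb1 hb2 hb0 rfl (fun r m => ?_) (fun r m => ?_) n
    · have := hNBU.mixedPoisson_Ici_add_le (lam := lam) hB' r m
      rw [Measure.real, Measure.real, Measure.real, ← ENNReal.toReal_mul]
      exact ENNReal.toReal_mono (ENNReal.mul_ne_top (measure_ne_top _ _) (measure_ne_top _ _)) this
    · have := mixedPoisson_Ici_mul_le hlam hB hmin r m
      rw [Measure.real, Measure.real, Measure.real, ← ENNReal.toReal_mul]
      exact ENNReal.toReal_mono (measure_ne_top _ _) this
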